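/- Identify sets of natural numbers with elements of $2^{\mathbb N}$; let $\le_T$ denote Turing reducibility, $A'$ the Turing jump of $A$, and $A\oplus B=\{2n:n\in A\}\cup\{2n+1:n\in B\}$. A binary tree is a set $T\subseteq 2^{<\mathbb N}$ closed under prefixes, $[T]$ is the set of its infinite paths, and $\mu(T)$ is the uniform (fair coin) measure of $[T]$. A real $r$ is $A$-computable if there is an $A$-computable sequence of dyadic rationals $(q_n)_{n\in\mathbb N}$ with $|r-q_n|\le 2^{-n}$ for all $n$. A coloring $f:[\mathbb N]^2\to\mathbb N$ is $2$-bounded if every color is the value of at most two pairs. It is rainbow-stable if for every $x$ either there is $y\ne x$ such that $f(x,s)=f(y,s)$ for all but finitely many $s$, or for all but finitely many $s$ there is no $y\neq x$ with $y<s$ and $f(x,s)=f(y,s)$. A set $R$ is a rainbow for $f$ if $f$ is injective on $[R]^2$. $\mathsf{SRRT}^2_2$ is the statement "every rainbow-stable $2$-bounded coloring $f:[\mathbb N]^2\to\mathbb N$ has an infinite rainbow". An $\omega$-model is given by a Turing ideal, i.e. a nonempty family $\mathcal M\subseteq 2^{\mathbb N}$ closed under $\oplus$ and downward closed under $\le_T$;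 it is a model of $\mathsf{SRRT}^2_2$ if every rainbow-stable $2$-bounded coloring whose graph belongs to $\mathcal M$ has an infinite rainbow belonging to $\mathcal M$. Theorem. (1) For every set $X$ and every $X'$-computable binary tree $T$ such that $\mu(T)$ is positive and $X'$-computable, there is a path $P\in[T]$ that is low over $X$, i.e. $(X\oplus P)'\le_T X'$. (2) Consequently, there is an $\omega$-model $\mathcal M$ of $\mathsf{SRRT}^2_2$ containing only low sets, i.e. $A'\le_T\emptyset'$ for every $A\in\mathcal M$. -/

import Mathlib

open MeasureTheory Filter

/-! ## Sets of natural numbers and relative computability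

Sets of integers are identified with their characteristic sequences, the elements of `ℕ → Bool`. -/

/-- The characteristic function of a set of integers, as an oracle. -/
def oracle (A : ℕ → Bool) : ℕ →. ℕ := fun n => Part.some (A n).toNat

/-- Turing reducibility `A ≤_T B` between sets of integers. -/
def SetTuringReducible (A B : ℕ → Bool) : Prop := TuringReducible (oracle A) (oracle B)

/-- A set of finite objects (such as binary strings) is `A`-computable if its characteristic
function is. -/
def SetComputableIn {α : Type*} [Primcodable α] (A : ℕ → Bool) (S : Set α) : Prop :=
  open Classical in ComputableIn {oracle A} (fun a : α => decide (a ∈ S))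

/-- The join `A ⊕ B = {2n : n ∈ A} ∪ {2n+1 : n ∈ B}`. -/
def join (A B : ℕ → Bool) : ℕ → Bool := fun n => if n % 2 = 0 then A (n / 2) else B (n / 2)

/-- The initial segment of length `k` of a sequence. -/
def initSeg (A : ℕ → Bool) (k : ℕ) : List Bool := (List.range k).map A

/-- `W_e^A`, the `e`-th set computably enumerable in `A`: the number `n` is in `W_e^A` if the
`e`-th program halts on `(n, σ)` for some initial segment `σ` of the oracle `A`. That these are
exactly the domains of the functions that are partial recursive in `A` is `ce_iff` below. -/
def relCE (A : ℕ → Bool) (e : ℕ) : Set ℕ :=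
  {n | ∃ k, ((Denumerable.ofNat Nat.Partrec.Code e).eval
    (Nat.pair n (Encodable.encode (initSeg A k)))).Dom}

/-- `F` computes `f` relative to `A`, from longer and longer initial segments of `A`. -/
structure UseApprox (A : ℕ → Bool) (F : List Bool → ℕ →. ℕ) (f : ℕ →. ℕ) : Prop where
  partrec : Partrec₂ F
  mono : ∀ {k l n m}, k ≤ l → m ∈ F (initSeg A k) n → m ∈ F (initSeg A l) n
  mem_iff : ∀ {n m}, m ∈ f n ↔ ∃ k, m ∈ F (initSeg A k) n

theorem UseApprox.of_partrec (A : ℕ → Bool) {f : ℕ →. ℕ} (hf : Nat.Partrec f) :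
    UseApprox A (fun _ => f) f :=
  ⟨(Partrec.nat_iff.2 hf).comp Computable.snd, fun _ h => h, by simp⟩

theorem UseApprox.rec_mono {A : ℕ → Bool} {F H : List Bool → ℕ →. ℕ} {f h : ℕ →. ℕ}
    (hF : UseApprox A F f) (hH : UseApprox A H h) {a k l : ℕ} (hkl : k ≤ l) (n : ℕ) :
    ∀ m, m ∈ (n.rec (F (initSeg A k) a) (fun y IH => IH.bind fun i =>
        H (initSeg A k) (Nat.pair a (Nat.pair y i))) : Part ℕ) →
      m ∈ (n.rec (F (initSeg A l) a) (fun y IH => IH.bind fun i =>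
        H (initSeg A l) (Nat.pair a (Nat.pair y i))) : Part ℕ) := by
  induction n with
  | zero => intro m hm; exact hF.mono hkl hm
  | succ n ih =>
    intro m hm
    obtain ⟨i, hi, hm⟩ := Part.mem_bind_iff.1 hm
    exact Part.mem_bind_iff.2 ⟨i, ih i hi, hH.mono hkl hm⟩

theorem mem_rfind_map {p : ℕ → Part ℕ} {m : ℕ} :
    m ∈ Nat.rfind (fun n => (p n).map fun m => decide (m = 0)) ↔
      0 ∈ p m ∧ ∀ j < m, ∃ y ∈ p j, y ≠ 0 := by
  refine Nat.mem_rfind.trans (and_congr ?_ (forall₂_congr fun j _ => ?_)) <;>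
    simp [Part.mem_map_iff]

theorem exists_useApprox (A : ℕ → Bool) {f : ℕ →. ℕ} (hf : Nat.RecursiveIn {oracle A} f) :
    ∃ F, UseApprox A F f := by
  induction hf with
  | zero => exact ⟨_, .of_partrec A .zero⟩
  | succ => exact ⟨_, .of_partrec A .succ⟩
  | left => exact ⟨_, .of_partrec A .left⟩
  | right => exact ⟨_, .of_partrec A .right⟩
  | oracle g hg =>
    obtain rfl := hg
    refine ⟨fun σ n => ((σ[n]?).map Bool.toNat : Option ℕ), ?_, ?_, ?_⟩
    · have h1 : Primrec Bool.toNat := Primrec.dom_finite _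
      exact (Primrec.option_map Primrec.list_getElem?
        (h1.comp Primrec.snd).to₂).to_comp.ofOption
    · intro k l n m hkl
      simp only [initSeg, Part.mem_ofOption, Option.mem_def, Option.map_eq_some_iff,
        List.getElem?_eq_some_iff]
      rintro ⟨b, ⟨h, rfl⟩, rfl⟩
      simp only [List.length_map, List.length_range] at h
      exact ⟨A n, ⟨by simpa using h.trans_le hkl, by simp⟩, by simp⟩
    · intro n m
      simp only [oracle, initSeg, Part.mem_some_iff, Part.mem_ofOption, Option.mem_def,
        Option.map_eq_some_iff, List.getElem?_eq_some_iff]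
      constructor
      · rintro rfl
        exact ⟨n + 1, A n, ⟨by simp, by simp⟩, rfl⟩
      · rintro ⟨k, b, ⟨h, rfl⟩, rfl⟩
        simp
  | @pair f h _ _ ihf ihh =>
    obtain ⟨F, hF⟩ := ihf
    obtain ⟨H, hH⟩ := ihh
    refine ⟨fun σ n => (F σ n).bind fun x => (H σ n).map fun y => Nat.pair x y, ?_, ?_, ?_⟩
    · exact hF.partrec.bind <| (hH.partrec.comp (Computable.fst.comp Computable.fst)
        (Computable.snd.comp Computable.fst)).map
        (Primrec₂.natPair.to_comp.comp (Computable.snd.comp Computable.fst) Computable.snd)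
    · intro k l n m hkl hm
      simp only [Part.mem_bind_iff, Part.mem_map_iff] at hm ⊢
      obtain ⟨x, hx, y, hy, rfl⟩ := hm
      exact ⟨x, hF.mono hkl hx, y, hH.mono hkl hy, rfl⟩
    · intro n m
      simp only [Seq.seq, Part.map_eq_map, Part.mem_bind_iff, Part.mem_map_iff]
      constructor
      · rintro ⟨_, ⟨x, hx, rfl⟩, y, hy, rfl⟩
        obtain ⟨k, hk⟩ := hF.mem_iff.1 hx
        obtain ⟨l, hl⟩ := hH.mem_iff.1 hy
        exact ⟨max k l, x, hF.mono (le_max_left _ _) hk, y, hH.mono (le_max_right _ _) hl, rfl⟩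
      · rintro ⟨k, x, hx, y, hy, rfl⟩
        exact ⟨_, ⟨x, hF.mem_iff.2 ⟨k, hx⟩, rfl⟩, y, hH.mem_iff.2 ⟨k, hy⟩, rfl⟩
  | @comp f h _ _ ihf ihh =>
    obtain ⟨F, hF⟩ := ihf
    obtain ⟨H, hH⟩ := ihh
    refine ⟨fun σ n => (H σ n).bind fun x => F σ x, ?_, ?_, ?_⟩
    · exact hH.partrec.bind (hF.partrec.comp (Computable.fst.comp Computable.fst) Computable.snd)
    · intro k l n m hkl hm
      obtain ⟨x, hx, hm⟩ := Part.mem_bind_iff.1 hm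
      exact Part.mem_bind_iff.2 ⟨x, hH.mono hkl hx, hF.mono hkl hm⟩
    · intro n m
      refine (Part.mem_bind_iff (f := h n) (g := f)).trans ?_
      simp only [Part.mem_bind_iff]
      constructor
      · rintro ⟨x, hx, hm⟩
        obtain ⟨k, hk⟩ := hH.mem_iff.1 hx
        obtain ⟨l, hl⟩ := hF.mem_iff.1 hm
        exact ⟨max k l, x, hH.mono (le_max_left _ _) hk, hF.mono (le_max_right _ _) hl⟩
      · rintro ⟨k, x, hx, hm⟩
        exact ⟨x, hH.mem_iff.2 ⟨k, hx⟩, hF.mem_iff.2 ⟨k, hm⟩⟩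
  | @prec f h _ _ ihf ihh =>
    obtain ⟨F, hF⟩ := ihf
    obtain ⟨H, hH⟩ := ihh
    refine ⟨fun σ p => (p.unpair.2.rec (F σ p.unpair.1) (fun y IH => IH.bind fun i =>
      H σ (Nat.pair p.unpair.1 (Nat.pair y i))) : Part ℕ), ?_, ?_, ?_⟩
    · refine Partrec.nat_rec (f := fun q : List Bool × ℕ => q.2.unpair.2)
        (g := fun q : List Bool × ℕ => F q.1 q.2.unpair.1)
        (h := fun (q : List Bool × ℕ) (r : ℕ × ℕ) =>
          H q.1 (Nat.pair q.2.unpair.1 (Nat.pair r.1 r.2))) ?_ ?_ ?_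
      · exact Computable.snd.comp (Computable.unpair.comp Computable.snd)
      · exact hF.partrec.comp Computable.fst
          (Computable.fst.comp (Computable.unpair.comp Computable.snd))
      · refine hH.partrec.comp (Computable.fst.comp Computable.fst) ?_
        refine Primrec₂.natPair.to_comp.comp (Computable.fst.comp (Computable.unpair.comp
          (Computable.snd.comp Computable.fst))) ?_
        exact Primrec₂.natPair.to_comp.comp (Computable.fst.comp Computable.snd)
          (Computable.snd.comp Computable.snd)
    · intro k l p m hkl hm
      exact hF.rec_mono hH hkl _ m hm
    · intro p m
      rcases hp : p.unpair with ⟨a, n⟩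
      simp only [Part.bind_eq_bind]
      clear hp
      induction n generalizing m with
      | zero => exact hF.mem_iff
      | succ n ih =>
        constructor
        · intro hm
          obtain ⟨i, hi, hm⟩ := Part.mem_bind_iff.1 hm
          obtain ⟨k, hk⟩ := ih.1 hi
          obtain ⟨l, hl⟩ := hH.mem_iff.1 hm
          exact ⟨max k l, Part.mem_bind_iff.2 ⟨i, hF.rec_mono hH (le_max_left _ _) n i hk,
            hH.mono (le_max_right _ _) hl⟩⟩
        · rintro ⟨k, hm⟩
          obtain ⟨i, hi, hm⟩ := Part.mem_bind_iff.1 hm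
          exact Part.mem_bind_iff.2 ⟨i, ih.2 ⟨k, hi⟩, hH.mem_iff.2 ⟨k, hm⟩⟩
  | @rfind f _ ihf =>
    obtain ⟨F, hF⟩ := ihf
    refine ⟨fun σ a => Nat.rfind fun n => (F σ (Nat.pair a n)).map fun m => decide (m = 0),
      ?_, ?_, ?_⟩
    · refine Partrec.rfind (p := fun (q : List Bool × ℕ) n =>
        (F q.1 (Nat.pair q.2 n)).map fun m => decide (m = 0)) ?_
      refine Partrec.map (f := fun r : (List Bool × ℕ) × ℕ => F r.1.1 (Nat.pair r.1.2 r.2))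
        (g := fun _ m => decide (m = 0)) ?_ ?_
      · exact hF.partrec.comp (Computable.fst.comp Computable.fst)
          (Primrec₂.natPair.to_comp.comp (Computable.snd.comp Computable.fst) Computable.snd)
      · exact (Primrec.eq.decide.comp Primrec.snd (Primrec.const 0)).to_comp
    · intro k l a m hkl hm
      obtain ⟨hx, h⟩ := mem_rfind_map.1 hm
      refine mem_rfind_map.2 ⟨hF.mono hkl hx, fun j hj => ?_⟩
      obtain ⟨y, hy, hy0⟩ := h j hj
      exact ⟨y, hF.mono hkl hy, hy0⟩
    · intro a m
      refine (mem_rfind_map (p := fun n => f (Nat.pair a n))).trans ?_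
      constructor
      · rintro ⟨hx, h⟩
        obtain ⟨k, hk⟩ := hF.mem_iff.1 hx
        have h' : ∃ l, ∀ j < m, ∃ y ∈ F (initSeg A l) (Nat.pair a j), y ≠ 0 := by
          clear hx hk
          induction m with
          | zero => exact ⟨0, by simp⟩
          | succ m ih =>
            obtain ⟨l, hl⟩ := ih fun j hj => h j (hj.trans (Nat.lt_succ_self m))
            obtain ⟨y, hy, hy0⟩ := h m (Nat.lt_succ_self m)
            obtain ⟨l', hl'⟩ := hF.mem_iff.1 hy
            refine ⟨max l l', fun j hj => ?_⟩
            rcases Nat.lt_succ_iff_lt_or_eq.1 hj with hj | rfl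
            · obtain ⟨z, hz, hz0⟩ := hl j hj
              exact ⟨z, hF.mono (le_max_left _ _) hz, hz0⟩
            · exact ⟨y, hF.mono (le_max_right _ _) hl', hy0⟩
        obtain ⟨l, hl⟩ := h'
        refine ⟨max k l, mem_rfind_map.2 ⟨hF.mono (le_max_left _ _) hk, fun j hj => ?_⟩⟩
        obtain ⟨y, hy, hy0⟩ := hl j hj
        exact ⟨y, hF.mono (le_max_right _ _) hy, hy0⟩
      · rintro ⟨k, hm⟩
        obtain ⟨hx, h⟩ := mem_rfind_map.1 hm
        refine ⟨hF.mem_iff.2 ⟨k, hx⟩, fun j hj => ?_⟩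
        obtain ⟨y, hy, hy0⟩ := h j hj
        exact ⟨y, hF.mem_iff.2 ⟨k, hy⟩, hy0⟩

theorem recursiveIn_encode_initSeg (A : ℕ → Bool) :
    Nat.RecursiveIn {oracle A} fun k => Part.some (Encodable.encode (initSeg A k)) := by
  have step : Nat.Primrec fun p =>
      Encodable.encode (((Encodable.decode (α := List Bool) p.unpair.1).getD []) ++
        [decide (p.unpair.2 = 1)]) := by
    rw [← Primrec.nat_iff]
    refine Primrec.encode.comp (Primrec.list_append.comp ?_ ?_)
    · exact Primrec.option_getD.comp
        (Primrec.decode.comp (Primrec.fst.comp Primrec.unpair)) (Primrec.const [])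
    · exact Primrec.list_cons.comp (Primrec.eq.decide.comp (Primrec.snd.comp Primrec.unpair)
        (Primrec.const 1)) (Primrec.const [])
  have hO : Nat.RecursiveIn {oracle A} (oracle A) := .oracle _ rfl
  have hy : Nat.RecursiveIn {oracle A} fun p => Part.some (p.unpair.2.unpair.1) :=
    (Nat.Primrec.recursiveIn (f := fun p => p.unpair.2.unpair.1)
      (Nat.Primrec.left.comp Nat.Primrec.right))
  have hi : Nat.RecursiveIn {oracle A} fun p => Part.some (p.unpair.2.unpair.2) :=
    (Nat.Primrec.recursiveIn (f := fun p => p.unpair.2.unpair.2)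
      (Nat.Primrec.right.comp Nat.Primrec.right))
  have hstep := Nat.RecursiveIn.comp (Nat.Primrec.recursiveIn (O := {oracle A}) step)
    (hi.pair (hO.comp hy))
  have hz : Nat.RecursiveIn {oracle A} fun _ =>
      Part.some (Encodable.encode ([] : List Bool)) :=
    Nat.Primrec.recursiveIn (f := fun _ => Encodable.encode ([] : List Bool))
      (Nat.Primrec.const _)
  have hrec := hz.prec hstep
  have hpair : Nat.RecursiveIn {oracle A} fun k => Part.some (Nat.pair 0 k) :=
    Nat.Primrec.recursiveIn (f := fun k => Nat.pair 0 k)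
      ((Nat.Primrec.const 0).pair Nat.Primrec.id)
  refine (hrec.comp hpair).of_eq fun k => ?_
  simp only [Part.bind_eq_bind, Part.bind_some, Nat.unpair_pair]
  induction k with
  | zero => simp [initSeg]
  | succ k ih =>
    simp only [ih]
    have h1 : (Part.some k >>= oracle A) = Part.some (A k).toNat := Part.bind_some _ _
    simp only [h1]
    cases hA : A k <;> simp [initSeg, List.range_succ, Seq.seq, hA]

/-- The sets `W_e^A` are exactly the domains of the functions that are partial recursive in `A`. -/
theorem ce_iff (A : ℕ → Bool) (W : Set ℕ) :
    (∃ f : ℕ →. ℕ, RecursiveIn {oracle A} f ∧ f.Dom = W) ↔ ∃ e, relCE A e = W := by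
  constructor
  · rintro ⟨f, hf, rfl⟩
    obtain ⟨F, hF⟩ := exists_useApprox A (RecursiveIn.iff_nat.1 hf)
    have hG : Partrec fun p : ℕ => (Part.ofOption
        (Encodable.decode (α := List Bool) p.unpair.2)).bind fun σ => F σ p.unpair.1 :=
      (Computable.decode.comp (Computable.snd.comp Computable.unpair)).ofOption.bind
        (hF.partrec.comp Computable.snd
          (Computable.fst.comp (Computable.unpair.comp Computable.fst)))
    obtain ⟨c, hc⟩ := Nat.Partrec.Code.exists_code.1 (Partrec.nat_iff.1 hG)
    refine ⟨Encodable.encode c, Set.ext fun n => ?_⟩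
    simp only [relCE, Set.mem_ofPred_eq, Denumerable.ofNat_encode, hc, Nat.unpair_pair,
      Encodable.encodek, Part.coe_some, Part.bind_some, PFun.mem_dom, Part.dom_iff_mem,
      hF.mem_iff]
    exact exists_comm
  · rintro ⟨e, rfl⟩
    set c := Denumerable.ofNat Nat.Partrec.Code e
    have hinit := recursiveIn_encode_initSeg A
    have htest : Nat.Primrec fun q =>
        1 - (Encodable.encode (Nat.Partrec.Code.evaln q.unpair.1 c q.unpair.2)) := by
      rw [← Primrec.nat_iff]
      refine Primrec.nat_sub.comp (Primrec.const 1) (Primrec.encode.comp ?_)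
      exact Nat.Partrec.Code.primrec_evaln.comp
        (((Primrec.fst.comp Primrec.unpair).pair (Primrec.const c)).pair
          (Primrec.snd.comp Primrec.unpair))
    have hleft : ∀ {g : ℕ → ℕ}, Nat.Primrec g →
        Nat.RecursiveIn {oracle A} fun p => Part.some (g p) := fun hg => hg.recursiveIn
    have hs := hleft (Nat.Primrec.left.comp Nat.Primrec.right)
    have hk := hleft (Nat.Primrec.right.comp Nat.Primrec.right)
    have hn := hleft Nat.Primrec.left
    have h := (Nat.RecursiveIn.comp (hleft htest) (hs.pair (hn.pair (hinit.comp hk)))).rfind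
    let g : ℕ →. ℕ := fun n => Nat.rfind fun q => Part.some (Nat.Partrec.Code.evaln q.unpair.1 c
      (Nat.pair n (Encodable.encode (initSeg A q.unpair.2)))).isSome
    have hg : Nat.RecursiveIn {oracle A} g := by
      refine h.of_eq fun n => congrArg Nat.rfind (funext fun q => ?_)
      have h1 : (Part.some (Nat.unpair (Nat.unpair (Nat.pair n q)).2).2 >>= fun k =>
          Part.some (Encodable.encode (initSeg A k))) =
          Part.some (Encodable.encode (initSeg A q.unpair.2)) := by
        simp only [Part.bind_eq_bind, Part.bind_some, Nat.unpair_pair]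
      rw [h1]
      cases h2 : Nat.Partrec.Code.evaln q.unpair.1 c
        (Nat.pair n (Encodable.encode (initSeg A q.unpair.2))) <;> simp [Seq.seq, h2]
    refine ⟨g, RecursiveIn.iff_nat.2 hg, Set.ext fun n => ?_⟩
    change (g n).Dom ↔ ∃ k, (c.eval (Nat.pair n (Encodable.encode (initSeg A k)))).Dom
    rw [Part.dom_iff_mem]
    simp only [Part.dom_iff_mem]
    constructor
    · rintro ⟨q, hq⟩
      obtain ⟨x, hx⟩ := Option.isSome_iff_exists.1 (Part.mem_some_iff.1 (Nat.mem_rfind.1 hq).1).symm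
      exact ⟨_, x, Nat.Partrec.Code.evaln_sound hx⟩
    · rintro ⟨k, x, hx⟩
      obtain ⟨s, hs⟩ := Nat.Partrec.Code.evaln_complete.1 hx
      have hex : ∃ q : ℕ, (Nat.Partrec.Code.evaln q.unpair.1 c
          (Nat.pair n (Encodable.encode (initSeg A q.unpair.2)))).isSome = true :=
        ⟨Nat.pair s k, by simpa using Option.isSome_iff_exists.2 ⟨x, hs⟩⟩
      refine ⟨Nat.find hex, Nat.mem_rfind.2 ⟨Part.mem_some_iff.2 (Nat.find_spec hex).symm,
        fun {j} hj => Part.mem_some_iff.2 ?_⟩⟩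
      simpa using Nat.find_min hex hj

/-- The Turing jump `A' = {e : e ∈ W_e^A}`. -/
noncomputable def jump (A : ℕ → Bool) : ℕ → Bool :=
  open Classical in fun e => decide (e ∈ relCE A e)

/-- `P` is low over `X`: `(X ⊕ P)' ≤_T X'`. -/
def LowOver (X P : ℕ → Bool) : Prop := SetTuringReducible (jump (join X P)) (jump X)

/-- `A` is low: `A' ≤_T ∅'`. -/
def Low (A : ℕ → Bool) : Prop := SetTuringReducible (jump A) (jump fun _ => false)

/-- A real number is `A`-computable if some `A`-computable sequence of dyadic rationals
`(a n - b n) / 2 ^ n` approximates it with error at most `2 ^ (-n)`. -/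
def RealComputableIn (A : ℕ → Bool) (r : ℝ) : Prop :=
  ∃ a b : ℕ → ℕ, ComputableIn {oracle A} a ∧ ComputableIn {oracle A} b ∧
    ∀ n, |r - ((a n : ℝ) - (b n : ℝ)) / 2 ^ n| ≤ (2 ^ n)⁻¹

/-! ## Binary trees and their measure -/

/-- A binary tree: a set of binary strings closed under prefixes. -/
def IsBinaryTree (T : Set (List Bool)) : Prop := ∀ σ τ : List Bool, σ <+: τ → τ ∈ T → σ ∈ T

/-- The set `[T]` of infinite paths of `T`. -/
def paths (T : Set (List Bool)) : Set (ℕ → Bool) := {P | ∀ n, initSeg P n ∈ T}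

/-- The uniform (fair coin) measure on Cantor space. -/
noncomputable def coinMeasure : Measure (ℕ → Bool) :=
  Measure.infinitePi fun _ : ℕ => (PMF.uniformOfFintype Bool).toMeasure

/-- The measure `μ(T)` of a binary tree: the uniform measure of its set of paths. -/
noncomputable def treeMeasure (T : Set (List Bool)) : ℝ := coinMeasure.real (paths T)

/-! ## The stable rainbow Ramsey theorem for pairs

A coloring of `[ℕ]²` is a function `f : ℕ → ℕ → ℕ` of which only the values `f x y` with `x < y`
are ever used. -/

/-- Every color is used for at most two pairs. -/
def TwoBounded (f : ℕ → ℕ → ℕ) : Prop :=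
  ∀ c, {p : ℕ × ℕ | p.1 < p.2 ∧ f p.1 p.2 = c}.encard ≤ 2

/-- For every `x`, either some `y ≠ x` has `f(x,s) = f(y,s)` for all but finitely many `s`, or, for
all but finitely many `s`, no `y ≠ x` has `f(x,s) = f(y,s)`. -/
def RainbowStable (f : ℕ → ℕ → ℕ) : Prop :=
  ∀ x, (∃ y, y ≠ x ∧ ∀ᶠ s in atTop, f x s = f y s) ∨
    (∀ᶠ s in atTop, ∀ y, y < s → y ≠ x → f x s ≠ f y s)

/-- `f` is injective on the pairs of elements of `R`. -/
def IsRainbow (f : ℕ → ℕ → ℕ) (R : ℕ → Bool) : Prop :=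
  ∀ x y x' y', R x = true → R y = true → R x' = true → R y' = true →
    x < y → x' < y' → f x y = f x' y' → x = x' ∧ y = y'

/-- The set of integers that codes the coloring: the graph of `f` on `[ℕ]²`. -/
noncomputable def coloringGraph (f : ℕ → ℕ → ℕ) : ℕ → Bool :=
  open Classical in
  fun n => decide (∃ x y, x < y ∧ n = Nat.pair (Nat.pair x y) (f x y))

/-- A Turing ideal: the second-order part of an `ω`-model of `RCA₀`. -/
structure IsTuringIdeal (M : Set (ℕ → Bool)) : Prop where
  nonempty : M.Nonempty
  join_mem : ∀ A ∈ M, ∀ B ∈ M, join A B ∈ M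
  mem_of_le : ∀ B ∈ M, ∀ A, SetTuringReducible A B → A ∈ M

/-- `M` satisfies `SRRT²₂`: every rainbow-stable 2-bounded coloring of pairs in `M` has an infinite
rainbow in `M`. -/
def SatisfiesSRRT22 (M : Set (ℕ → Bool)) : Prop :=
  ∀ f : ℕ → ℕ → ℕ, coloringGraph f ∈ M → TwoBounded f → RainbowStable f →
    ∃ R ∈ M, {n | R n = true}.Infinite ∧ IsRainbow f R

/-! ## Closure properties of relative computability -/

/-! Part (1). Let `U i` be the open set of oracles `P` with `i ∈ (X ⊕ P)'`. It is the increasing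
union of the clopen sets "halts by stage `t`", whose measures are computable in `X`. So `X'` can
find a stage after which `U i` gains as little measure as desired (`exists_halting_stage`). Fix such
stages `t i`, and remove from `[T]` every `P` that enters some `U i` only after stage `t i`. If the
allowed losses sum to less than `μ(T)`, the remaining set `K` has positive measure. It is closed,
because its `i`-th condition is the complement of an open set united with a clopen set. On `K` the
jump is decided by waiting until `t i`, so any `X'`-computable member of `K` is low over `X`.

Such a member exists because `X'` approximates `K` from above by clopen sets with known error:
computability of `μ(T)` gives levels of `T` close to `[T]` (`exists_level_approx`), and later
halting stages bound the error for the other conditions. One then repeatedly moves to the half that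
looks heavier (`exists_computableIn_mem`). `exists_path_lowOver` combines these steps.

Part (2). Call `x` and `y` partners if they eventually receive the same colors. Stability makes this
a limit of decidable relations that converges for every pair, hence decidable in `X'`; 2-boundedness
allows at most one partner. Take longer and longer prefixes of a random sequence, coded as numbers.
A short prefix determines at most one long prefix as its partner, so with positive probability no
two of these numbers are partners, and the tree of such sequences satisfies the hypotheses of
`exists_path_lowOver` (`exists_low_avoiding`). In a partner-free infinite set, every finite rainbow
is extended by all sufficiently large elements, so a greedy search finds an infinite rainbow
(`exists_low_rainbow`).

Lowness over a low set is lowness, so the construction can be iterated. Low sets are computable in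
`∅'`, hence countably many colorings have to be handled, and the sets below some stage form the
model (`exists_low_model`). -/

namespace RecursiveIn

variable {α β σ : Type*} [Primcodable α] [Primcodable β] [Primcodable σ] {O : Set (ℕ →. ℕ)}

open Encodable

theorem comp {f : β →. σ} {g : α → β} (hf : RecursiveIn O f) (hg : ComputableIn O g) :
    RecursiveIn O fun a => f (g a) :=
  (Nat.RecursiveIn.comp hf hg).of_eq fun n => by
    rcases e : decode (α := α) n with - | a <;> simp [encodek]

theorem rfind {p : α → ℕ → Bool} (hp : ComputableIn₂ O p) :
    RecursiveIn O fun a => Nat.rfind fun n => Part.some (p a n) := by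
  -- Unbounded search looks for a zero, so truth is coded by 0.
  have h0 : ComputableIn O fun b : Bool => cond b 0 1 :=
    (Primrec.dom_bool fun b => cond b 0 1).computableIn
  refine (Nat.RecursiveIn.rfind (RecursiveIn.comp h0 hp)).of_eq fun n => ?_
  rcases e : decode (α := α) n with - | a
  · simp only [Part.map_eq_map, Part.coe_none, Part.bind_none]
    refine Nat.rfind_zero_none _ ?_
    simp [e]
  · simp only [Part.map_eq_map, Part.coe_some, Part.bind_some]
    refine Eq.trans (congrArg Nat.rfind (funext fun m => ?_)) (Part.map_id' (fun x => rfl) _).symm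
    cases h : p a m <;> simp [e, h]

end RecursiveIn

namespace ComputableIn

variable {α β γ σ : Type*} [Primcodable α] [Primcodable β] [Primcodable γ] [Primcodable σ]
  {O : Set (ℕ →. ℕ)}

open Encodable

theorem of_eq {f g : α → σ} (hf : ComputableIn O f) (H : ∀ a, f a = g a) : ComputableIn O g :=
  (funext H : f = g) ▸ hf

theorem comp {f : β → σ} {g : α → β} (hf : ComputableIn O f) (hg : ComputableIn O g) :
    ComputableIn O fun a => f (g a) :=
  RecursiveIn.comp (f := fun b => Part.some (f b)) hf hg

theorem pair {f : α → β} {g : α → γ} (hf : ComputableIn O f) (hg : ComputableIn O g) :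
    ComputableIn O fun a => (f a, g a) :=
  (Nat.RecursiveIn.pair hf hg).of_eq fun n => by
    cases decode (α := α) n <;> simp [Seq.seq]

theorem of_primrec_comp {f : β → σ} {g : α → β} (hf : Primrec f) (hg : ComputableIn O g) :
    ComputableIn O fun a => f (g a) :=
  hf.computableIn.comp hg

theorem of_primrec_comp₂ {f : β → γ → σ} {g : α → β} {h : α → γ} (hf : Primrec₂ f)
    (hg : ComputableIn O g) (hh : ComputableIn O h) : ComputableIn O fun a => f (g a) (h a) :=
  comp (f := fun p : β × γ => f p.1 p.2) (Primrec.computableIn hf) (hg.pair hh)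

theorem nat_rec {f : α → ℕ} {g : α → σ} {h : (α × ℕ) × σ → σ} (hf : ComputableIn O f)
    (hg : ComputableIn O g) (hh : ComputableIn O h) :
    ComputableIn O fun a =>
      Nat.rec (motive := fun _ => σ) (g a) (fun y IH => h ((a, y), IH)) (f a) := by
  have hh' : ComputableIn O fun p : α × ℕ × σ => h ((p.1, p.2.1), p.2.2) :=
    hh.comp ((ComputableIn.fst.pair (ComputableIn.fst.comp ComputableIn.snd)).pair
      (ComputableIn.snd.comp ComputableIn.snd))
  have hid : Nat.RecursiveIn O Part.some :=
    Nat.Primrec.recursiveIn (f := fun n => n) Nat.Primrec.id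
  have := (Nat.RecursiveIn.comp (Nat.RecursiveIn.prec hg hh') (Nat.RecursiveIn.pair hid hf))
  refine this.of_eq fun n => ?_
  rcases e : decode (α := α) n with - | a
  · simp [Seq.seq]
  · simp only [Seq.seq, Part.map_eq_map, Part.map_some, Part.bind_eq_bind, Part.bind_some,
      Part.coe_some, Nat.unpair_pair, e]
    induction f a <;> simp_all

theorem cond {c : α → Bool} {f g : α → σ} (hc : ComputableIn O c) (hf : ComputableIn O f)
    (hg : ComputableIn O g) : ComputableIn O fun a => bif c a then f a else g a := by
  have h : Primrec fun p : Bool × σ × σ => bif p.1 then p.2.1 else p.2.2 :=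
    Primrec.cond Primrec.fst (Primrec.fst.comp Primrec.snd) (Primrec.snd.comp Primrec.snd)
  exact h.computableIn.comp (hc.pair (hf.pair hg))

theorem exists_search {p : α → ℕ → Bool} (hp : ComputableIn₂ O p)
    (H : ∀ a, ∃ n, p a n = true) : ∃ g : α → ℕ, ComputableIn O g ∧ ∀ a, p a (g a) = true := by
  refine ⟨fun a => Nat.find (H a), ?_, fun a => Nat.find_spec (H a)⟩
  refine (RecursiveIn.rfind hp).of_eq_tot fun a => ?_
  refine Nat.mem_rfind.2 ⟨?_, fun {m} hm => ?_⟩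
  · simp [Nat.find_spec (H a)]
  · simpa using Nat.find_min (H a) hm

theorem list_map_range {f : α → ℕ → σ} {n : α → ℕ} (hf : ComputableIn₂ O f)
    (hn : ComputableIn O n) : ComputableIn O fun a => (List.range (n a)).map (f a) := by
  have hc : Primrec₂ fun (l : List σ) (x : σ) => l ++ [x] := Primrec.list_concat
  have := ComputableIn.nat_rec (O := O) hn (ComputableIn.const ([] : List σ))
    (of_primrec_comp₂ (f := fun (l : List σ) (x : σ) => l ++ [x]) hc ComputableIn.snd
      (hf.comp ComputableIn.fst) :
      ComputableIn O fun p : (α × ℕ) × List σ => p.2 ++ [f p.1.1 p.1.2])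
  refine this.of_eq fun a => ?_
  induction n a with
  | zero => rfl
  | succ k ih => simp only [List.range_succ, List.map_append, ← ih]; rfl

end ComputableIn

/-! ## Decidability relative to an oracle -/

/-- The predicate `p` is decidable relative to the oracle `A`. -/
def DecidableIn (A : ℕ → Bool) {α : Type*} [Primcodable α] (p : α → Prop) : Prop :=
  ∃ b : α → Bool, ComputableIn {oracle A} b ∧ ∀ a, b a = true ↔ p a

theorem setComputableIn_iff {α : Type*} [Primcodable α] {A : ℕ → Bool} {S : Set α} :
    SetComputableIn A S ↔ DecidableIn A (fun a => a ∈ S) := by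
  constructor
  · exact fun h => ⟨_, h, fun a => by simp⟩
  · rintro ⟨b, hb, h⟩
    refine hb.of_eq fun a => ?_
    by_cases ha : a ∈ S
    · simp [ha, (h a).2 ha]
    · simp only [ha, decide_false]
      exact Bool.eq_false_iff.2 fun hb => ha ((h a).1 hb)

theorem computableIn_oracle (A : ℕ → Bool) : ComputableIn {oracle A} A := by
  have h : RecursiveIn {oracle A} (oracle A) := RecursiveIn.oracle _ rfl
  have h1 : ComputableIn {oracle A} fun n => (A n).toNat := h
  refine (ComputableIn.comp (f := fun n : ℕ => decide (n = 1))
    (Primrec.eq.decide.comp Primrec.id (Primrec.const 1)).computableIn h1).of_eq fun n => ?_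
  cases A n <;> simp

theorem setTuringReducible_iff {A B : ℕ → Bool} :
    SetTuringReducible A B ↔ ComputableIn {oracle B} A := by
  constructor
  · intro h
    exact RecursiveIn.subst (computableIn_oracle A) (by rintro g rfl; exact h)
  · intro h
    have h1 : Primrec Bool.toNat := Primrec.dom_finite _
    exact h1.computableIn.comp h

theorem ComputableIn.of_reducible {α σ : Type*} [Primcodable α] [Primcodable σ] {A B : ℕ → Bool}
    {f : α → σ} (hf : ComputableIn {oracle A} f) (h : SetTuringReducible A B) :
    ComputableIn {oracle B} f :=
  RecursiveIn.subst hf (by rintro g rfl; exact h)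

theorem SetTuringReducible.refl (A : ℕ → Bool) : SetTuringReducible A A := TuringReducible.refl _

theorem SetTuringReducible.trans {A B C : ℕ → Bool} (h₁ : SetTuringReducible A B)
    (h₂ : SetTuringReducible B C) : SetTuringReducible A C := TuringReducible.trans h₁ h₂

theorem computableIn_initSeg (A : ℕ → Bool) : ComputableIn {oracle A} (initSeg A) :=
  ComputableIn.list_map_range (α := ℕ) (f := fun _ n => A n)
    ((computableIn_oracle A).comp ComputableIn.snd) ComputableIn.id

namespace DecidableIn

variable {α β : Type*} [Primcodable α] [Primcodable β] {A B : ℕ → Bool} {p q : α → Prop}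

theorem of_iff (h : DecidableIn A p) (H : ∀ a, p a ↔ q a) : DecidableIn A q := by
  obtain ⟨b, hb, h⟩ := h
  exact ⟨b, hb, fun a => (h a).trans (H a)⟩

theorem of_reducible (h : DecidableIn A p) (hAB : SetTuringReducible A B) : DecidableIn B p := by
  obtain ⟨b, hb, h⟩ := h
  exact ⟨b, hb.of_reducible hAB, h⟩

theorem comp {p : β → Prop} (h : DecidableIn A p) {f : α → β} (hf : ComputableIn {oracle A} f) :
    DecidableIn A fun a => p (f a) := by
  obtain ⟨b, hb, h⟩ := h
  exact ⟨_, hb.comp hf, fun a => h _⟩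

theorem of_primrecPred (h : PrimrecPred p) : DecidableIn A p := by
  obtain ⟨_, h⟩ := h
  exact ⟨_, h.computableIn, fun a => by simp⟩

theorem of_primrecRel_comp {β γ : Type*} [Primcodable β] [Primcodable γ] {r : β → γ → Prop}
    (h : PrimrecRel r) {f : α → β} {g : α → γ} (hf : ComputableIn {oracle A} f)
    (hg : ComputableIn {oracle A} g) : DecidableIn A fun a => r (f a) (g a) :=
  DecidableIn.comp (p := fun p : β × γ => r p.1 p.2) (of_primrecPred h) (hf.pair hg)

theorem eq {β : Type*} [Primcodable β] {f g : α → β} (hf : ComputableIn {oracle A} f)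
    (hg : ComputableIn {oracle A} g) : DecidableIn A fun a => f a = g a :=
  of_primrecRel_comp Primrec.eq hf hg

theorem le {f g : α → ℕ} (hf : ComputableIn {oracle A} f) (hg : ComputableIn {oracle A} g) :
    DecidableIn A fun a => f a ≤ g a :=
  of_primrecRel_comp Primrec.nat_le hf hg

theorem lt {f g : α → ℕ} (hf : ComputableIn {oracle A} f) (hg : ComputableIn {oracle A} g) :
    DecidableIn A fun a => f a < g a :=
  of_primrecRel_comp Primrec.nat_lt hf hg

theorem not (h : DecidableIn A p) : DecidableIn A fun a => ¬ p a := by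
  obtain ⟨b, hb, h⟩ := h
  exact ⟨_, Primrec.not.computableIn.comp hb, fun a => by simp [← h]⟩

theorem and (hp : DecidableIn A p) (hq : DecidableIn A q) : DecidableIn A fun a => p a ∧ q a := by
  obtain ⟨b, hb, h⟩ := hp
  obtain ⟨c, hc, h'⟩ := hq
  exact ⟨_, ComputableIn.of_primrec_comp₂ Primrec.and hb hc, fun a => by simp [← h, ← h']⟩

theorem imp (hp : DecidableIn A p) (hq : DecidableIn A q) : DecidableIn A fun a => p a → q a :=
  (hp.and hq.not).not.of_iff fun a => by simp

theorem computableIn_decide (h : DecidableIn A p) :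
    ComputableIn {oracle A} (open Classical in fun a => decide (p a)) := by
  obtain ⟨b, hb, h⟩ := h
  refine hb.of_eq fun a => ?_
  rw [eq_comm, Bool.eq_iff_iff, h]
  simp

theorem exists_search {p : α × ℕ → Prop} (hp : DecidableIn A p) (H : ∀ a, ∃ n, p (a, n)) :
    ∃ g : α → ℕ, ComputableIn {oracle A} g ∧ ∀ a, p (a, g a) := by
  obtain ⟨b, hb, h⟩ := hp
  obtain ⟨g, hg, hg'⟩ := ComputableIn.exists_search (p := fun a n => b (a, n))
    (hb.of_eq fun _ => rfl) fun a => (H a).imp fun n hn => (h _).2 hn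
  exact ⟨g, hg, fun a => (h _).1 (hg' a)⟩

theorem forall_lt {p : α × ℕ → Prop} (hp : DecidableIn A p) {f : α → ℕ}
    (hf : ComputableIn {oracle A} f) : DecidableIn A fun a => ∀ n < f a, p (a, n) := by
  obtain ⟨b, hb, h⟩ := hp
  have h1 := ComputableIn.list_map_range (f := fun a n => b (a, n)) (hb.of_eq fun _ => rfl) hf
  have h2 : PrimrecPred fun l : List Bool => ∀ x ∈ l, x = true :=
    PrimrecPred.forall_mem_list (Primrec.eq.comp Primrec.id (Primrec.const true))
  exact ((of_primrecPred h2).comp h1).of_iff fun a => by simp [h]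

theorem exists_lt {p : α × ℕ → Prop} (hp : DecidableIn A p) {f : α → ℕ}
    (hf : ComputableIn {oracle A} f) : DecidableIn A fun a => ∃ n < f a, p (a, n) :=
  (hp.not.forall_lt hf).not.of_iff fun a => by simp

theorem forall_mem_list {β : Type*} [Primcodable β] [Inhabited β] {p : α × β → Prop}
    (hp : DecidableIn A p) {f : α → List β} (hf : ComputableIn {oracle A} f) :
    DecidableIn A fun a => ∀ x ∈ f a, p (a, x) := by
  -- The list is scanned by index; `default` is never reached, since the indices stay below the
  -- length.
  have hget : ComputableIn {oracle A} fun q : α × ℕ => (f q.1).getD q.2 default :=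
    ComputableIn.of_primrec_comp₂ (f := fun l n => List.getD l n default) (Primrec.list_getD default)
      (hf.comp ComputableIn.fst)
      ComputableIn.snd
  have := (hp.comp (ComputableIn.fst.pair hget)).forall_lt
    (ComputableIn.of_primrec_comp Primrec.list_length hf)
  refine this.of_iff fun a => ?_
  rw [List.forall_mem_iff_getElem]
  refine forall₂_congr fun n hn => ?_
  simp [hn]

end DecidableIn

/-! ## The jump -/

theorem jump_eq_true_iff {A : ℕ → Bool} {e : ℕ} : jump A e = true ↔ e ∈ relCE A e := by
  simp [jump]

theorem mem_relCE_iff_evaln {A : ℕ → Bool} {e n : ℕ} : n ∈ relCE A e ↔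
    ∃ k t, (Nat.Partrec.Code.evaln t (Denumerable.ofNat Nat.Partrec.Code e)
      (Nat.pair n (Encodable.encode (initSeg A k)))).isSome := by
  simp only [relCE, Set.mem_ofPred_eq, Part.dom_iff_mem, Nat.Partrec.Code.evaln_complete,
    Option.isSome_iff_exists, Option.mem_def]
  exact exists_congr fun k => exists_comm

/-- The domain of a function that is partial recursive in `A` is many-one reducible to `A'`. -/
theorem exists_primrec_jump_iff_dom {A : ℕ → Bool} {f : ℕ →. ℕ}
    (hf : Nat.RecursiveIn {oracle A} f) :
    ∃ g : ℕ → ℕ, Primrec g ∧ ∀ x, jump A (g x) = true ↔ (f x).Dom := by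
  obtain ⟨F, hF⟩ := exists_useApprox A hf
  have hG : Partrec fun p : ℕ => (Part.ofOption
      (Encodable.decode (α := List Bool) p.unpair.2.unpair.2)).bind fun σ => F σ p.unpair.1 :=
    (Computable.decode.comp (Computable.snd.comp (Computable.unpair.comp
      (Computable.snd.comp Computable.unpair)))).ofOption.bind
      (hF.partrec.comp Computable.snd
        (Computable.fst.comp (Computable.unpair.comp Computable.fst)))
  obtain ⟨c, hc⟩ := Nat.Partrec.Code.exists_code.1 (Partrec.nat_iff.1 hG)
  -- The s-m-n theorem: `x` is hard-wired into the program, which ignores its own input and reads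
  -- only the oracle segment. Hence its index belongs to its own domain exactly when `f x`
  -- converges.
  refine ⟨fun x => Encodable.encode (c.curry x), Primrec.encode.comp
    (Nat.Partrec.Code.primrec₂_curry.comp (Primrec.const c) Primrec.id), fun x => ?_⟩
  simp only [jump_eq_true_iff, relCE, Set.mem_ofPred_eq, Denumerable.ofNat_encode,
    Nat.Partrec.Code.eval_curry, hc, Nat.unpair_pair, Encodable.encodek, Part.coe_some,
    Part.bind_some, Part.dom_iff_mem, hF.mem_iff]
  exact exists_comm

/-- Existential quantification over a predicate decidable in `A` is decidable in `A'`. -/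
theorem DecidableIn.exists_jump {α : Type*} [Primcodable α] {A : ℕ → Bool} {p : α × ℕ → Prop}
    (hp : DecidableIn A p) : DecidableIn (jump A) fun a => ∃ n, p (a, n) := by
  obtain ⟨b, hb, h⟩ := hp
  have h1 := RecursiveIn.rfind (p := fun a n => b (a, n)) (hb.of_eq fun _ => rfl)
  obtain ⟨g, hg, hg'⟩ := exists_primrec_jump_iff_dom h1
  refine ⟨fun a => jump A (g (Encodable.encode a)), (computableIn_oracle _).comp
    (hg.comp Primrec.encode).computableIn, fun a => ?_⟩
  rw [hg']
  simp only [Encodable.encodek, Part.coe_some, Part.bind_some]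
  refine (Nat.rfind_dom (p := fun n => Part.some (b (a, n)))).trans ?_
  simp [h]

theorem DecidableIn.forall_jump {α : Type*} [Primcodable α] {A : ℕ → Bool} {p : α × ℕ → Prop}
    (hp : DecidableIn A p) : DecidableIn (jump A) fun a => ∀ n, p (a, n) :=
  hp.not.exists_jump.not.of_iff fun a => by simp

theorem DecidableIn.exists_exists_jump {α : Type*} [Primcodable α] {A : ℕ → Bool}
    {p : (α × ℕ) × ℕ → Prop} (hp : DecidableIn A p) :
    DecidableIn (jump A) fun a => ∃ m n, p ((a, m), n) := by
  have hu : Primrec fun q : α × ℕ => ((q.1, q.2.unpair.1), q.2.unpair.2) :=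
    (Primrec.fst.pair (Primrec.fst.comp (Primrec.unpair.comp Primrec.snd))).pair
      (Primrec.snd.comp (Primrec.unpair.comp Primrec.snd))
  refine (hp.comp hu.computableIn).exists_jump.of_iff fun a => ⟨fun ⟨n, hn⟩ => ⟨_, _, hn⟩, ?_⟩
  rintro ⟨m, n, h⟩
  exact ⟨Nat.pair m n, by simpa using h⟩

theorem DecidableIn.setTuringReducible {A B : ℕ → Bool} (h : DecidableIn B fun n => A n = true) :
    SetTuringReducible A B :=
  setTuringReducible_iff.2 <| h.computableIn_decide.of_eq fun n => by simp

theorem decidableIn_oracle (A : ℕ → Bool) : DecidableIn A fun n => A n = true :=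
  ⟨A, computableIn_oracle A, fun _ => Iff.rfl⟩

theorem setTuringReducible_jump (A : ℕ → Bool) : SetTuringReducible A (jump A) := by
  refine DecidableIn.setTuringReducible ?_
  exact (((decidableIn_oracle A).comp (ComputableIn.fst (β := ℕ))).exists_jump).of_iff
    fun a => by simp

theorem primrec_evaln_isSome : PrimrecPred fun q : ℕ × ℕ × ℕ =>
    (Nat.Partrec.Code.evaln q.1 (Denumerable.ofNat Nat.Partrec.Code q.2.1) q.2.2).isSome = true :=
  Primrec.eq.comp (Primrec.option_isSome.comp (Nat.Partrec.Code.primrec_evaln.comp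
    ((Primrec.fst.pair ((Primrec.ofNat _).comp (Primrec.fst.comp Primrec.snd))).pair
      (Primrec.snd.comp Primrec.snd)))) (Primrec.const true)

/-- Membership in `A'` is an existential statement over step-bounded computations. Their halting is
decidable in `A`, hence in `B`, and the jump of `B` absorbs the quantifiers. -/
theorem SetTuringReducible.jump {A B : ℕ → Bool} (h : SetTuringReducible A B) :
    SetTuringReducible (jump A) (jump B) := by
  have hd : DecidableIn A fun q : (ℕ × ℕ) × ℕ =>
      (Nat.Partrec.Code.evaln q.2 (Denumerable.ofNat Nat.Partrec.Code q.1.1)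
        (Nat.pair q.1.1 (Encodable.encode (initSeg A q.1.2)))).isSome = true := by
    have h1 : ComputableIn {oracle A} fun q : (ℕ × ℕ) × ℕ =>
        Nat.pair q.1.1 (Encodable.encode (initSeg A q.1.2)) :=
      ComputableIn.of_primrec_comp₂ Primrec₂.natPair
        (ComputableIn.fst.comp ComputableIn.fst)
        (ComputableIn.of_primrec_comp Primrec.encode
          ((computableIn_initSeg A).comp (ComputableIn.snd.comp ComputableIn.fst)))
    exact (DecidableIn.of_primrecPred primrec_evaln_isSome).comp
      (ComputableIn.snd.pair ((ComputableIn.fst.comp ComputableIn.fst).pair h1))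
  refine DecidableIn.setTuringReducible ?_
  exact (hd.of_reducible h).exists_exists_jump.of_iff fun e => by
    rw [jump_eq_true_iff, mem_relCE_iff_evaln]

/-- The limit of an eventually constant `A`-decidable predicate is decidable in `A'`. -/
theorem DecidableIn.eventually_jump {α : Type*} [Primcodable α] {A : ℕ → Bool} {p : α × ℕ → Prop}
    (hp : DecidableIn A p)
    (H : ∀ a, (∀ᶠ s in atTop, p (a, s)) ∨ ∀ᶠ s in atTop, ¬ p (a, s)) :
    DecidableIn (jump A) fun a => ∀ᶠ s in atTop, p (a, s) := by
  have hpair : ComputableIn {oracle A} fun q : (α × ℕ) × ℕ => (q.1.1, q.1.2 + q.2) :=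
    (ComputableIn.fst.comp ComputableIn.fst).pair
      (ComputableIn.of_primrec_comp₂ Primrec.nat_add (ComputableIn.snd.comp ComputableIn.fst)
        ComputableIn.snd)
  -- Here `p` has the same truth value at `s` and at `s + k`. Holding for all `k` says that `s` is a
  -- modulus of convergence; the jump decides this and can search for such an `s`.
  have h1 : DecidableIn A fun q : (α × ℕ) × ℕ => (p q.1 → p (q.1.1, q.1.2 + q.2)) ∧
      (¬ p q.1 → ¬ p (q.1.1, q.1.2 + q.2)) :=
    ((hp.comp ComputableIn.fst).imp (hp.comp hpair)).and
      ((hp.comp ComputableIn.fst).not.imp (hp.comp hpair).not)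
  obtain ⟨g, hg, hg'⟩ := h1.forall_jump.exists_search fun a => by
    rcases H a with h | h <;> obtain ⟨N, hN⟩ := eventually_atTop.1 h <;>
      refine ⟨N, fun n => ?_⟩
    · exact ⟨fun _ => hN _ (Nat.le_add_right _ _), fun h' => (h' (hN _ le_rfl)).elim⟩
    · exact ⟨fun h' => (hN _ le_rfl h').elim, fun _ => hN _ (Nat.le_add_right _ _)⟩
  refine ((hp.of_reducible (setTuringReducible_jump A)).comp (ComputableIn.id.pair hg)).of_iff
    fun a => ⟨fun h => ?_, fun h => ?_⟩
  · refine eventually_atTop.2 ⟨g a, fun s hs => ?_⟩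
    obtain ⟨k, rfl⟩ := Nat.exists_eq_add_of_le hs
    exact (hg' a k).1 h
  · by_contra hn
    obtain ⟨N, hN⟩ := eventually_atTop.1 h
    exact (hg' a N).2 hn (hN _ (Nat.le_add_left _ _))

/-! ## Joins -/

theorem join_two_mul (A B : ℕ → Bool) (n : ℕ) : join A B (2 * n) = A n := by simp [_root_.join]

theorem join_two_mul_add_one (A B : ℕ → Bool) (n : ℕ) : join A B (2 * n + 1) = B n := by
  have : (2 * n + 1) / 2 = n := by omega
  simp [_root_.join, Nat.add_mod, this]

theorem left_le_join (A B : ℕ → Bool) : SetTuringReducible A (join A B) :=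
  setTuringReducible_iff.2 <| ((computableIn_oracle (join A B)).comp
    Primrec.nat_double.computableIn).of_eq fun n => join_two_mul A B n

theorem right_le_join (A B : ℕ → Bool) : SetTuringReducible B (join A B) :=
  setTuringReducible_iff.2 <| ((computableIn_oracle (join A B)).comp
    Primrec.nat_double_succ.computableIn).of_eq fun n => join_two_mul_add_one A B n

theorem join_le {A B C : ℕ → Bool} (hA : SetTuringReducible A C) (hB : SetTuringReducible B C) :
    SetTuringReducible (join A B) C := by
  have hdiv : ComputableIn {oracle C} fun n : ℕ => n / 2 :=
    (Primrec.nat_div.comp Primrec.id (Primrec.const 2)).computableIn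
  have hmod : ComputableIn {oracle C} fun n : ℕ => decide (n % 2 = 0) :=
    (Primrec.eq.decide.comp (Primrec.nat_mod.comp Primrec.id (Primrec.const 2))
      (Primrec.const 0)).computableIn
  refine setTuringReducible_iff.2 <| (hmod.cond ((setTuringReducible_iff.1 hA).comp hdiv)
    ((setTuringReducible_iff.1 hB).comp hdiv)).of_eq fun n => ?_
  by_cases h : n % 2 = 0 <;> simp [_root_.join, h]

theorem Low.of_reducible {A B : ℕ → Bool} (hB : Low B) (h : SetTuringReducible A B) : Low A :=
  h.jump.trans hB

theorem Low.le_jump_empty {A : ℕ → Bool} (hA : Low A) :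
    SetTuringReducible A (jump fun _ => false) :=
  (setTuringReducible_jump A).trans hA

theorem LowOver.low_join {X P : ℕ → Bool} (h : LowOver X P) (hX : Low X) : Low (join X P) :=
  SetTuringReducible.trans h hX

theorem low_empty : Low fun _ => false := SetTuringReducible.refl _

/-! ## Initial segments -/

@[simp] theorem length_initSeg (P : ℕ → Bool) (n : ℕ) : (initSeg P n).length = n := by
  simp [initSeg]

@[simp] theorem initSeg_zero (P : ℕ → Bool) : initSeg P 0 = [] := rfl

theorem initSeg_succ (P : ℕ → Bool) (n : ℕ) : initSeg P (n + 1) = initSeg P n ++ [P n] := by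
  simp [initSeg, List.range_succ]

@[simp] theorem getElem_initSeg (P : ℕ → Bool) (n i : ℕ) (h : i < (initSeg P n).length) :
    (initSeg P n)[i] = P i := by
  simp [initSeg]

theorem getD_initSeg (P : ℕ → Bool) {n i : ℕ} (h : i < n) (b : Bool) :
    (initSeg P n).getD i b = P i := by
  rw [List.getD_eq_getElem _ _ (by simpa using h)]; simp

theorem initSeg_eq_iff {P Q : ℕ → Bool} {n : ℕ} :
    initSeg P n = initSeg Q n ↔ ∀ i < n, P i = Q i := by
  simp [initSeg]

theorem take_initSeg (P : ℕ → Bool) {m n : ℕ} (h : m ≤ n) :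
    (initSeg P n).take m = initSeg P m := by
  simp [initSeg, ← List.map_take, List.take_range, h]

theorem initSeg_eq_of_le {P Q : ℕ → Bool} {m n : ℕ} (h : m ≤ n) (hPQ : initSeg P n = initSeg Q n) :
    initSeg P m = initSeg Q m := by
  rw [← take_initSeg P h, hPQ, take_initSeg Q h]

theorem initSeg_getD (σ : List Bool) : initSeg (fun i => σ.getD i false) σ.length = σ := by
  refine List.ext_getElem (by simp) fun i h₁ h₂ => ?_
  simp [h₂]

/-! ## Counting binary strings -/

/-- The list of all binary strings of length `n`. -/
def binaryStrings : ℕ → List (List Bool)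
  | 0 => [[]]
  | n + 1 => (binaryStrings n).flatMap fun σ => [σ ++ [false], σ ++ [true]]

theorem mem_binaryStrings {n : ℕ} {σ : List Bool} : σ ∈ binaryStrings n ↔ σ.length = n := by
  induction n generalizing σ with
  | zero => simp [binaryStrings]
  | succ n ih =>
    simp only [binaryStrings, List.mem_flatMap, ih, List.mem_cons, List.not_mem_nil, or_false]
    constructor
    · rintro ⟨τ, rfl, rfl | rfl⟩ <;> simp
    · intro h
      rcases List.eq_nil_or_concat' σ with rfl | ⟨τ, b, rfl⟩
      · simp at h
      · refine ⟨τ, by simpa using h, ?_⟩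
        cases b <;> simp

theorem nodup_binaryStrings (n : ℕ) : (binaryStrings n).Nodup := by
  induction n with
  | zero => simp [binaryStrings]
  | succ n ih =>
    refine List.nodup_flatMap.2 ⟨fun σ _ => by simp, ih.imp fun {σ τ} h => ?_⟩
    simp only [Function.onFun, List.disjoint_left, List.mem_cons, List.not_mem_nil, or_false]
    rintro ρ (rfl | rfl) (h' | h') <;> exact h (List.append_inj_left' h' rfl)

theorem primrec_binaryStrings : Primrec binaryStrings := by
  have hs : ∀ b : Bool, Primrec₂ fun (_ : ℕ × List (List Bool)) (σ : List Bool) => σ ++ [b] :=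
    fun b => Primrec.list_append.comp Primrec.snd (Primrec.const [b])
  have h1 : Primrec₂ fun (_ : ℕ × List (List Bool)) (σ : List Bool) =>
      [σ ++ [false], σ ++ [true]] :=
    Primrec.list_cons.comp (hs false) (Primrec.list_cons.comp (hs true) (Primrec.const []))
  refine (Primrec.nat_rec₁ [[]] (Primrec.list_flatMap Primrec.snd h1).to₂).of_eq fun n => ?_
  induction n with
  | zero => rfl
  | succ n ih => simp only [binaryStrings, ← ih]

open Classical in
/-- The number of binary strings of length `n` that satisfy `p`. -/
noncomputable def countStrings (p : List Bool → Prop) (n : ℕ) : ℕ :=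
  (binaryStrings n).countP fun σ => decide (p σ)

theorem computableIn_countStrings {α : Type*} [Primcodable α] {A : ℕ → Bool}
    {p : α × List Bool → Prop} (hp : DecidableIn A p) {n : α → ℕ}
    (hn : ComputableIn {oracle A} n) :
    ComputableIn {oracle A} fun a => countStrings (fun τ => p (a, τ)) (n a) := by
  classical
  have hl : ComputableIn {oracle A} fun a => binaryStrings (n a) :=
    primrec_binaryStrings.computableIn.comp hn
  have hget : ComputableIn {oracle A} fun q : α × ℕ => (binaryStrings (n q.1)).getD q.2 [] :=
    ComputableIn.of_primrec_comp₂ (f := fun l n => List.getD l n []) (Primrec.list_getD [])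
      (hl.comp ComputableIn.fst) ComputableIn.snd
  have hd := (hp.comp (ComputableIn.fst.pair hget)).computableIn_decide
  have hm := ComputableIn.list_map_range
    (f := fun a i => decide (p (a, (binaryStrings (n a)).getD i [])))
    hd (ComputableIn.of_primrec_comp Primrec.list_length hl)
  have hc : Primrec fun l : List Bool => (l.filter fun x => x = true).length :=
    Primrec.list_length.comp (Primrec.listFilter (Primrec.eq.comp Primrec.id (Primrec.const true)))
  refine (hc.computableIn.comp hm).of_eq fun a => ?_
  rw [countStrings, ← List.countP_eq_length_filter]
  have : (List.range (binaryStrings (n a)).length).map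
      (fun i => decide (p (a, (binaryStrings (n a)).getD i []))) =
      (binaryStrings (n a)).map fun σ => decide (p (a, σ)) := by
    refine List.ext_getElem (by simp) fun i h₁ h₂ => ?_
    have : i < (binaryStrings (n a)).length := by simpa using h₁
    simp [this]
  rw [this, List.countP_map]
  congr 1
  funext σ
  simp

/-! ## The coin measure -/

instance : IsProbabilityMeasure coinMeasure := by unfold coinMeasure; infer_instance

theorem coinMeasure_cylinder (σ : List Bool) :
    coinMeasure {P | initSeg P σ.length = σ} = (1 / 2) ^ σ.length := by
  have : {P : ℕ → Bool | initSeg P σ.length = σ} =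
      Set.pi (Finset.range σ.length : Set ℕ) fun i => {σ.getD i false} := by
    ext P
    simp only [Set.mem_ofPred_eq, Set.mem_pi, Finset.coe_range, Set.mem_Iio, Set.mem_singleton_iff]
    conv_lhs => rw [← initSeg_getD σ]
    simp only [length_initSeg, initSeg_eq_iff]
  rw [this, coinMeasure, Measure.infinitePi_pi _ (fun _ _ => MeasurableSet.singleton _)]
  simp

theorem measurableSet_initSeg (p : List Bool → Prop) (n : ℕ) :
    MeasurableSet {P | p (initSeg P n)} := by
  have h : Measurable fun P : ℕ → Bool => fun i : Fin n => P i :=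
    measurable_pi_lambda _ fun i => measurable_pi_apply _
  have : {P | p (initSeg P n)} = (fun P : ℕ → Bool => fun i : Fin n => P i) ⁻¹'
      {v | p (List.ofFn v)} := by
    ext P
    have : initSeg P n = List.ofFn fun i : Fin n => P i :=
      List.ext_getElem (by simp) fun i h₁ h₂ => by simp
    simp [this]
  rw [this]
  exact h (Set.toFinite _).measurableSet

theorem coinMeasure_initSeg (p : List Bool → Prop) (n : ℕ) :
    coinMeasure.real {P | p (initSeg P n)} = countStrings p n / 2 ^ n := by
  classical
  set S : Finset (List Bool) := (binaryStrings n).toFinset.filter p with hS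
  have h1 : {P | p (initSeg P n)} = ⋃ σ ∈ S, {P | initSeg P n = σ} := by
    ext P; simp [hS, mem_binaryStrings]
  have h2 : ∀ σ ∈ S, coinMeasure.real {P | initSeg P n = σ} = (1 / 2) ^ n := by
    intro σ hσ
    have hl : σ.length = n := by simpa [mem_binaryStrings] using (Finset.mem_filter.1 hσ).1
    subst hl
    simp [Measure.real, coinMeasure_cylinder]
  have h3 : S.card = countStrings p n := by
    rw [countStrings, List.countP_eq_length_filter,
      ← List.toFinset_card_of_nodup ((nodup_binaryStrings n).filter _), List.toFinset_filter, hS]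
    simp
  rw [h1, measureReal_biUnion_finset, Finset.sum_congr rfl h2]
  · simp [h3, div_eq_mul_inv]
  · intro σ _ τ _ hne
    exact Set.disjoint_left.2 fun P h h' => hne (h.symm.trans h')
  · exact fun σ _ => measurableSet_initSeg (fun τ => τ = σ) n

/-- The geometric series `∑ 2^-(i+m+1) = 2^-m`. This union bound fixes the exponents chosen for
stages and levels below. -/
theorem coinMeasure_iUnion_le {E : ℕ → Set (ℕ → Bool)} {m : ℕ}
    (h : ∀ i, coinMeasure.real (E i) ≤ (1 / 2) ^ (i + m + 1)) :
    coinMeasure.real (⋃ i, E i) ≤ (1 / 2) ^ m := by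
  have hs : HasSum (fun i : ℕ => (1 / 2 : ℝ) ^ (i + m + 1)) ((1 / 2) ^ m) := by
    have := hasSum_geometric_two.mul_left ((1 / 2 : ℝ) ^ (m + 1))
    rw [show (1 / 2 : ℝ) ^ (m + 1) * 2 = (1 / 2) ^ m by ring,
      show (fun i : ℕ => (1 / 2 : ℝ) ^ (m + 1) * (1 / 2) ^ i) = fun i => (1 / 2) ^ (i + m + 1) by
        funext i; ring] at this
    exact this
  have h1 : coinMeasure (⋃ i, E i) ≤ ENNReal.ofReal ((1 / 2) ^ m) := by
    rw [← hs.tsum_eq, ENNReal.ofReal_tsum_of_nonneg (fun i => by positivity) hs.summable]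
    refine (measure_iUnion_le E).trans (ENNReal.tsum_le_tsum fun i => ?_)
    rw [← ofReal_measureReal]
    exact ENNReal.ofReal_le_ofReal (h i)
  exact ENNReal.toReal_le_of_le_ofReal (by positivity) h1

/-- Continuity from below: a bound on an increasing sequence bounds the union. -/
theorem coinMeasure_iUnion_diff_le {E : ℕ → Set (ℕ → Bool)} (hE : Monotone E)
    (hm : ∀ t, MeasurableSet (E t)) {s : ℕ} {ε : ℝ}
    (h : ∀ t, coinMeasure.real (E t) ≤ coinMeasure.real (E s) + ε) :
    coinMeasure.real ((⋃ t, E t) \ E s) ≤ ε := by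
  rw [measureReal_sdiff (Set.subset_iUnion E s) (hm s)]
  have ht := tendsto_measure_iUnion_atTop (μ := coinMeasure) hE
  have ht' := (ENNReal.tendsto_toReal (measure_ne_top coinMeasure _)).comp ht
  have := le_of_tendsto' ht' h
  rw [sub_le_iff_le_add']
  exact this

/-! ## Computing a path through a closed set whose measure is computable -/

/-- Length `L + σ.length` suffices for both conditions and depends on `σ` only through its length,
so for siblings comparing counts is comparing measures. -/
theorem coinMeasure_inter_cylinder (p : List Bool → Prop) (L : ℕ) (σ : List Bool) :
    coinMeasure.real ({P | p (initSeg P L)} ∩ {P | initSeg P σ.length = σ}) =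
      countStrings (fun τ => p (τ.take L) ∧ τ.take σ.length = σ) (L + σ.length) /
        2 ^ (L + σ.length) := by
  rw [← coinMeasure_initSeg]
  congr 1
  ext P
  simp [take_initSeg]

/-- If the closed set `K` of positive measure is approximated from above by `A`-computable clopen
sets with computable error, then `K` has an `A`-computable element. -/
theorem exists_computableIn_mem {A : ℕ → Bool} {K : Set (ℕ → Bool)}
    (hclosed : ∀ P, (∀ k, ∃ P' ∈ K, initSeg P' k = initSeg P k) → P ∈ K)
    (hpos : 0 < coinMeasure.real K) {Q : ℕ × List Bool → Prop} (hQ : DecidableIn A Q)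
    {L : ℕ → ℕ} (hL : ComputableIn {oracle A} L) (hKQ : ∀ n, ∀ P ∈ K, Q (n, initSeg P (L n)))
    (hε : ∀ n, coinMeasure.real ({P | Q (n, initSeg P (L n))} \ K) ≤ (1 / 2) ^ n) :
    ∃ P ∈ K, ComputableIn {oracle A} P := by
  classical
  set cyl : List Bool → Set (ℕ → Bool) := fun σ => {P | initSeg P σ.length = σ} with hcyl
  set cnt : ℕ × List Bool → ℕ := fun q => countStrings
    (fun τ => Q (q.1, τ.take (L q.1)) ∧ τ.take q.2.length = q.2) (L q.1 + q.2.length) with hcnt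
  have hcntC : ComputableIn {oracle A} cnt := by
    have hL' : ComputableIn {oracle A} fun q : ℕ × List Bool => L q.1 := hL.comp ComputableIn.fst
    have hlen : ComputableIn {oracle A} fun q : ℕ × List Bool => q.2.length :=
      (Primrec.list_length.comp Primrec.snd).computableIn
    have h1 : DecidableIn A fun r : (ℕ × List Bool) × List Bool =>
        Q (r.1.1, r.2.take (L r.1.1)) ∧ r.2.take r.1.2.length = r.1.2 := by
      refine (hQ.comp ((ComputableIn.fst.comp ComputableIn.fst).pair
        (ComputableIn.of_primrec_comp₂ Primrec.list_take (hL'.comp ComputableIn.fst)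
          ComputableIn.snd))).and (DecidableIn.eq ?_ (ComputableIn.snd.comp ComputableIn.fst))
      exact ComputableIn.of_primrec_comp₂ Primrec.list_take (hlen.comp ComputableIn.fst)
        ComputableIn.snd
    exact computableIn_countStrings h1 (ComputableIn.of_primrec_comp₂ Primrec.nat_add hL' hlen)
  -- Start of the invariant `μ(K ∩ cyl σ) ≥ 2 * 2^-(2|σ|+c)`, maintained along the path.
  obtain ⟨c, hc⟩ : ∃ c : ℕ, 2 * (1 / 2 : ℝ) ^ c ≤ coinMeasure.real K := by
    obtain ⟨c, hc⟩ := exists_pow_lt_of_lt_one (half_pos hpos) (by norm_num : (1 / 2 : ℝ) < 1)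
    exact ⟨c, by linarith⟩
  set b : List Bool → Bool := fun σ => decide
    (cnt (2 * σ.length + c, σ ++ [false]) < cnt (2 * σ.length + c, σ ++ [true])) with hb
  have hbC : ComputableIn {oracle A} b := by
    have h1 : ∀ d : Bool, ComputableIn {oracle A} fun σ : List Bool =>
        cnt (2 * σ.length + c, σ ++ [d]) := fun d =>
      hcntC.comp (Primrec.pair (Primrec.nat_add.comp (Primrec.nat_double.comp Primrec.list_length)
        (Primrec.const c)) (Primrec.list_append.comp Primrec.id (Primrec.const [d]))).computableIn
    exact (DecidableIn.lt (h1 false) (h1 true)).computableIn_decide.of_eq fun σ => by simp [hb]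
  -- With `n = 2|σ|+c`, the rejected half exceeds the chosen one by at most `2^-n`. So the chosen
  -- half has measure at least `(2 * 2^-n - 2^-n) / 2 = 2 * 2^-(n+2)`, the invariant one level
  -- further.
  have key : ∀ σ : List Bool, 2 * (1 / 2 : ℝ) ^ (2 * σ.length + c) ≤ coinMeasure.real (K ∩ cyl σ) →
      2 * (1 / 2 : ℝ) ^ (2 * (σ.length + 1) + c) ≤ coinMeasure.real (K ∩ cyl (σ ++ [b σ])) := by
    intro σ hσ
    set n := 2 * σ.length + c with hn
    have hle : ∀ τ, coinMeasure.real (K ∩ cyl τ) ≤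
        coinMeasure.real ({P | Q (n, initSeg P (L n))} ∩ cyl τ) := fun τ =>
      measureReal_mono (Set.inter_subset_inter_left _ (hKQ n))
    have hge : ∀ τ, coinMeasure.real ({P | Q (n, initSeg P (L n))} ∩ cyl τ) ≤
        coinMeasure.real (K ∩ cyl τ) + (1 / 2) ^ n := fun τ => by
      refine (measureReal_mono ?_).trans ((measureReal_union_le _ _).trans
        (add_le_add le_rfl (hε n)))
      rintro P ⟨h1, h2⟩
      by_cases hP : P ∈ K
      · exact Or.inl ⟨hP, h2⟩
      · exact Or.inr ⟨h1, hP⟩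
    have hval : ∀ d, coinMeasure.real ({P | Q (n, initSeg P (L n))} ∩ cyl (σ ++ [d])) =
        cnt (n, σ ++ [d]) / 2 ^ (L n + (σ.length + 1)) := fun d => by
      have := coinMeasure_inter_cylinder (fun τ => Q (n, τ)) (L n) (σ ++ [d])
      simpa [hcyl, hcnt] using this
    have hsum : coinMeasure.real (K ∩ cyl σ) ≤
        coinMeasure.real (K ∩ cyl (σ ++ [false])) + coinMeasure.real (K ∩ cyl (σ ++ [true])) := by
      refine (measureReal_mono ?_).trans (measureReal_union_le _ _)
      rintro P ⟨h1, h2⟩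
      have h2' : initSeg P σ.length = σ := h2
      cases h : P σ.length
      · exact Or.inl ⟨h1, by simp [hcyl, initSeg_succ, h, h2']⟩
      · exact Or.inr ⟨h1, by simp [hcyl, initSeg_succ, h, h2']⟩
    have hcmp : ∀ d, coinMeasure.real ({P | Q (n, initSeg P (L n))} ∩ cyl (σ ++ [d])) ≤
        coinMeasure.real ({P | Q (n, initSeg P (L n))} ∩ cyl (σ ++ [b σ])) := fun d => by
      rw [hval, hval]
      refine div_le_div_of_nonneg_right ?_ (by positivity)
      rw [Nat.cast_le]
      by_cases hlt : cnt (n, σ ++ [false]) < cnt (n, σ ++ [true])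
      · have : b σ = true := by simpa [hb] using hlt
        rw [this]
        cases d
        · exact hlt.le
        · exact le_rfl
      · have : b σ = false := by simpa [hb] using hlt
        rw [this]
        cases d
        · exact le_rfl
        · exact not_lt.1 hlt
    have h0 := (hle _).trans ((hcmp false).trans (hge _))
    have h1 := (hle _).trans ((hcmp true).trans (hge _))
    have hp : (1 / 2 : ℝ) ^ (2 * (σ.length + 1) + c) = (1 / 2) ^ n / 4 := by
      rw [hn]; ring
    rw [hp]
    cases hbσ : b σ <;> rw [hbσ] at h0 h1 <;> linarith
  set S : ℕ → List Bool := fun k => Nat.rec [] (fun _ σ => σ ++ [b σ]) k with hS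
  have hSC : ComputableIn {oracle A} S :=
    ComputableIn.nat_rec (h := fun q : (ℕ × ℕ) × List Bool => q.2 ++ [b q.2]) ComputableIn.id
      (ComputableIn.const []) (ComputableIn.of_primrec_comp₂
        (f := fun (l : List Bool) (x : Bool) => l ++ [x]) Primrec.list_concat ComputableIn.snd
        (hbC.comp ComputableIn.snd))
  set P : ℕ → Bool := fun k => b (S k) with hP
  have hPS : ∀ k, initSeg P k = S k := fun k => by
    induction k with
    | zero => rfl
    | succ k ih => rw [initSeg_succ, ih]
  have hinv : ∀ k, 2 * (1 / 2 : ℝ) ^ (2 * k + c) ≤ coinMeasure.real (K ∩ cyl (initSeg P k)) := by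
    intro k
    induction k with
    | zero => simpa [hcyl] using hc
    | succ k ih =>
      have := key (initSeg P k) (by simpa using ih)
      rw [length_initSeg] at this
      rwa [initSeg_succ, show P k = b (initSeg P k) by rw [hPS]]
  refine ⟨P, hclosed P fun k => ?_, hbC.comp hSC⟩
  have hne : (K ∩ cyl (initSeg P k)).Nonempty := by
    rw [Set.nonempty_iff_ne_empty]
    intro h
    have := hinv k
    rw [h, measureReal_empty] at this
    exact absurd this (not_le.2 (by positivity))
  obtain ⟨P', h1, h2⟩ := hne
  exact ⟨P', h1, by simpa [hcyl] using h2⟩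

/-! ## Forcing the jump -/

/-- The infinite extension of a binary string by `false`. -/
def extend (τ : List Bool) : ℕ → Bool := fun n => τ.getD n false

theorem initSeg_extend {P : ℕ → Bool} {t m : ℕ} (h : t ≤ m) :
    initSeg (extend (initSeg P m)) t = initSeg P t :=
  initSeg_eq_iff.2 fun _ hi => getD_initSeg P (hi.trans_le h) false

/-- The `i`-th program halts on input `i` within `t` steps, with the oracle `X ⊕ P` of which only
the first `t` digits are used. -/
def HaltsBy (X : ℕ → Bool) (i t : ℕ) (P : ℕ → Bool) : Prop :=
  ∃ k < t + 1, (Nat.Partrec.Code.evaln t (Denumerable.ofNat Nat.Partrec.Code i)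
    (Nat.pair i (Encodable.encode (initSeg (join X P) k)))).isSome = true

theorem HaltsBy.congr {X P Q : ℕ → Bool} {i t : ℕ} (h : initSeg P t = initSeg Q t)
    (hP : HaltsBy X i t P) : HaltsBy X i t Q := by
  obtain ⟨k, hk, hP⟩ := hP
  refine ⟨k, hk, ?_⟩
  have : initSeg (join X P) k = initSeg (join X Q) k := initSeg_eq_iff.2 fun n hn => by
    have := initSeg_eq_iff.1 h (n / 2) (by omega)
    simp [_root_.join, this]
  rwa [← this]

theorem haltsBy_congr {X P Q : ℕ → Bool} {i t : ℕ} (h : initSeg P t = initSeg Q t) :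
    HaltsBy X i t P ↔ HaltsBy X i t Q :=
  ⟨.congr h, .congr h.symm⟩

theorem HaltsBy.mono {X P : ℕ → Bool} {i t u : ℕ} (h : t ≤ u) (hP : HaltsBy X i t P) :
    HaltsBy X i u P := by
  obtain ⟨k, hk, hP⟩ := hP
  obtain ⟨x, hx⟩ := Option.isSome_iff_exists.1 hP
  exact ⟨k, by omega, Option.isSome_iff_exists.2 ⟨x, Nat.Partrec.Code.evaln_mono h hx⟩⟩

theorem mem_relCE_join_iff {X P : ℕ → Bool} {i : ℕ} :
    i ∈ relCE (join X P) i ↔ ∃ t, HaltsBy X i t P := by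
  rw [mem_relCE_iff_evaln]
  constructor
  · rintro ⟨k, t, h⟩
    obtain ⟨x, hx⟩ := Option.isSome_iff_exists.1 h
    exact ⟨max k t, k, Nat.lt_succ_of_le (le_max_left _ _), Option.isSome_iff_exists.2
      ⟨x, Nat.Partrec.Code.evaln_mono (le_max_right _ _) hx⟩⟩
  · rintro ⟨t, k, -, h⟩
    exact ⟨k, t, h⟩

theorem decidableIn_haltsBy (X : ℕ → Bool) :
    DecidableIn X fun q : (ℕ × ℕ) × List Bool => HaltsBy X q.1.1 q.1.2 (extend q.2) := by
  have hj : ComputableIn {oracle X} fun r : (((ℕ × ℕ) × List Bool) × ℕ) × ℕ =>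
      join X (extend r.1.1.2) r.2 := by
    have hdiv : ComputableIn {oracle X} fun r : (((ℕ × ℕ) × List Bool) × ℕ) × ℕ => r.2 / 2 :=
      (Primrec.nat_div.comp Primrec.snd (Primrec.const 2)).computableIn
    have hmod : ComputableIn {oracle X} fun r : (((ℕ × ℕ) × List Bool) × ℕ) × ℕ =>
        decide (r.2 % 2 = 0) :=
      (Primrec.eq.decide.comp (Primrec.nat_mod.comp Primrec.snd (Primrec.const 2))
        (Primrec.const 0)).computableIn
    have he : ComputableIn {oracle X} fun r : (((ℕ × ℕ) × List Bool) × ℕ) × ℕ =>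
        extend r.1.1.2 (r.2 / 2) :=
      ComputableIn.of_primrec_comp₂ (f := fun l n => List.getD l n false)
        (Primrec.list_getD false) (Primrec.snd.comp (Primrec.fst.comp Primrec.fst)).computableIn
        hdiv
    refine (hmod.cond ((computableIn_oracle X).comp hdiv) he).of_eq fun r => ?_
    by_cases h : r.2 % 2 = 0 <;> simp [_root_.join, h]
  have hs : ComputableIn {oracle X} fun r : ((ℕ × ℕ) × List Bool) × ℕ =>
      initSeg (join X (extend r.1.2)) r.2 :=
    ComputableIn.list_map_range (f := fun (r : ((ℕ × ℕ) × List Bool) × ℕ) n =>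
      join X (extend r.1.2) n) hj ComputableIn.snd
  have hi : Primrec fun r : ((ℕ × ℕ) × List Bool) × ℕ => r.1.1.1 :=
    Primrec.fst.comp (Primrec.fst.comp Primrec.fst)
  have ht : Primrec fun r : ((ℕ × ℕ) × List Bool) × ℕ => r.1.1.2 :=
    Primrec.snd.comp (Primrec.fst.comp Primrec.fst)
  exact ((DecidableIn.of_primrecPred primrec_evaln_isSome).comp
    (ht.computableIn.pair (hi.computableIn.pair (ComputableIn.of_primrec_comp₂ Primrec₂.natPair
      hi.computableIn (ComputableIn.of_primrec_comp Primrec.encode hs))))).exists_lt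
    (Primrec.succ.comp (Primrec.snd.comp Primrec.fst)).computableIn

theorem primrec_two_pow : Primrec fun n : ℕ => 2 ^ n :=
  (Primrec₂.unpaired'.1 Nat.Primrec.pow).comp (Primrec.const 2) Primrec.id

theorem ComputableIn.two_pow {α : Type*} [Primcodable α] {A : ℕ → Bool} {f : α → ℕ}
    (hf : ComputableIn {oracle A} f) : ComputableIn {oracle A} fun a => 2 ^ f a :=
  ComputableIn.of_primrec_comp primrec_two_pow hf

theorem ComputableIn.mul {α : Type*} [Primcodable α] {A : ℕ → Bool} {f g : α → ℕ}
    (hf : ComputableIn {oracle A} f) (hg : ComputableIn {oracle A} g) :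
    ComputableIn {oracle A} fun a => f a * g a :=
  ComputableIn.of_primrec_comp₂ Primrec.nat_mul hf hg

theorem ComputableIn.add {α : Type*} [Primcodable α] {A : ℕ → Bool} {f g : α → ℕ}
    (hf : ComputableIn {oracle A} f) (hg : ComputableIn {oracle A} g) :
    ComputableIn {oracle A} fun a => f a + g a :=
  ComputableIn.of_primrec_comp₂ Primrec.nat_add hf hg

theorem setOf_haltsBy (X : ℕ → Bool) (i t : ℕ) : {P | HaltsBy X i t P} =
    {P | HaltsBy X i t (extend (initSeg P t))} := by
  ext P
  exact haltsBy_congr (initSeg_extend le_rfl).symm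

theorem measurableSet_haltsBy (X : ℕ → Bool) (i t : ℕ) : MeasurableSet {P | HaltsBy X i t P} := by
  rw [setOf_haltsBy]
  exact measurableSet_initSeg (fun τ => HaltsBy X i t (extend τ)) t

theorem coinMeasure_haltsBy (X : ℕ → Bool) (i t : ℕ) :
    coinMeasure.real {P | HaltsBy X i t P} =
      countStrings (fun τ => HaltsBy X i t (extend τ)) t / 2 ^ t := by
  rw [setOf_haltsBy]
  exact coinMeasure_initSeg (fun τ => HaltsBy X i t (extend τ)) t

/-- The jump of `X` computes stages by which all but a small measure of the oracles that will make
a program halt have done so. -/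
theorem exists_halting_stage (X : ℕ → Bool) : ∃ s : ℕ × ℕ → ℕ, ComputableIn {oracle (jump X)} s ∧
    ∀ i n, coinMeasure.real ({P | i ∈ relCE (join X P) i} \ {P | HaltsBy X i (s (i, n)) P}) ≤
      (1 / 2) ^ n := by
  set N : ℕ × ℕ → ℕ := fun q => countStrings (fun τ => HaltsBy X q.1 q.2 (extend τ)) q.2 with hN
  have hNC : ComputableIn {oracle X} N :=
    computableIn_countStrings (decidableIn_haltsBy X) ComputableIn.snd
  -- The comparison of measures in `hiff` with denominators cleared. Its universal closure over the
  -- later stage `u` is decided by `X'`.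
  have hd : DecidableIn X fun q : ((ℕ × ℕ) × ℕ) × ℕ =>
      N (q.1.1.1, q.2) * (2 ^ q.1.1.2 * 2 ^ q.1.2) ≤
        (N (q.1.1.1, q.1.2) * 2 ^ q.1.1.2 + 2 ^ q.1.2) * 2 ^ q.2 := by
    have hi : ComputableIn {oracle X} fun q : ((ℕ × ℕ) × ℕ) × ℕ => q.1.1.1 :=
      (Primrec.fst.comp (Primrec.fst.comp Primrec.fst)).computableIn
    have hn : ComputableIn {oracle X} fun q : ((ℕ × ℕ) × ℕ) × ℕ => q.1.1.2 :=
      (Primrec.snd.comp (Primrec.fst.comp Primrec.fst)).computableIn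
    have ht : ComputableIn {oracle X} fun q : ((ℕ × ℕ) × ℕ) × ℕ => q.1.2 :=
      (Primrec.snd.comp Primrec.fst).computableIn
    have hu : ComputableIn {oracle X} fun q : ((ℕ × ℕ) × ℕ) × ℕ => q.2 := ComputableIn.snd
    exact DecidableIn.le ((hNC.comp (hi.pair hu)).mul (hn.two_pow.mul ht.two_pow))
      ((((hNC.comp (hi.pair ht)).mul hn.two_pow).add ht.two_pow).mul hu.two_pow)
  have hiff : ∀ i n t u, N (i, u) * (2 ^ n * 2 ^ t) ≤ (N (i, t) * 2 ^ n + 2 ^ t) * 2 ^ u ↔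
      coinMeasure.real {P | HaltsBy X i u P} ≤
        coinMeasure.real {P | HaltsBy X i t P} + (1 / 2) ^ n := by
    intro i n t u
    rw [coinMeasure_haltsBy, coinMeasure_haltsBy, one_div, inv_pow, ← one_div,
      div_add_div _ _ (by positivity) (by positivity), div_le_div_iff₀ (by positivity)
      (by positivity), ← Nat.cast_le (α := ℝ)]
    push_cast
    rw [mul_one, mul_comm ((2 : ℝ) ^ n)]
  have hmono : ∀ i, Monotone fun t => {P | HaltsBy X i t P} := fun i t u h P hP => HaltsBy.mono h hP
  obtain ⟨s, hs, hs'⟩ := hd.forall_jump.exists_search fun ⟨i, n⟩ => by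
    -- A stage whose measure is within `2^-n` of the supremum over all stages.
    obtain ⟨t, ht⟩ : ∃ t, ∀ u, coinMeasure.real {P | HaltsBy X i u P} ≤
        coinMeasure.real {P | HaltsBy X i t P} + (1 / 2) ^ n := by
      have hb : BddAbove (Set.range fun t => coinMeasure.real {P | HaltsBy X i t P}) :=
        ⟨1, by rintro _ ⟨t, rfl⟩; exact measureReal_le_one⟩
      obtain ⟨t, ht⟩ := exists_lt_of_lt_ciSup
        (sub_lt_self (⨆ t, coinMeasure.real {P | HaltsBy X i t P})
          (by positivity : (0 : ℝ) < (1 / 2) ^ n))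
      exact ⟨t, fun u => (le_ciSup hb u).trans (sub_le_iff_le_add.1 ht.le)⟩
    exact ⟨t, fun u => (hiff i n t u).2 (ht u)⟩
  refine ⟨s, hs, fun i n => ?_⟩
  have hU : {P | i ∈ relCE (join X P) i} = ⋃ t, {P | HaltsBy X i t P} := by
    ext P
    simp [mem_relCE_join_iff]
  rw [hU]
  exact coinMeasure_iUnion_diff_le (hmono i) (measurableSet_haltsBy X i)
    fun u => (hiff i n _ u).1 (hs' (i, n) u)

/-- A path that is low over `X`, from explicit clopen approximations of the tree. -/
theorem exists_path_lowOver {X : ℕ → Bool} {T : Set (List Bool)}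
    (hT : DecidableIn (jump X) fun σ => σ ∈ T) (hpos : 0 < treeMeasure T) {L : ℕ → ℕ}
    (hL : ComputableIn {oracle (jump X)} L)
    (hε : ∀ n, coinMeasure.real ({P | initSeg P (L n) ∈ T} \ paths T) ≤ (1 / 2) ^ n) :
    ∃ P ∈ paths T, LowOver X P := by
  obtain ⟨s, hs, hs'⟩ := exists_halting_stage X
  obtain ⟨c, hc⟩ := exists_pow_lt_of_lt_one hpos (by norm_num : (1 / 2 : ℝ) < 1)
  have half_pow : ∀ {m n : ℕ}, m ≤ n → (1 / 2 : ℝ) ^ n ≤ (1 / 2) ^ m := fun h =>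
    pow_le_pow_of_le_one (by norm_num) (by norm_num) h
  -- The stages `t i` define `K`: the losses sum to at most `2^-c < μ(T)`. The factor 2 makes the
  -- loss at most `2^-(i+n+2)` once `i ≥ n`, so the conditions ignored by the `n`-th approximation
  -- cost little. The stages `u (n, i)` replace the open set `U i` by a clopen one in that
  -- approximation.
  set t : ℕ → ℕ := fun i => s (i, 2 * i + c + 2) with ht
  set u : ℕ × ℕ → ℕ := fun q => s (q.2, q.2 + q.1 + 2) with hu
  have htC : ComputableIn {oracle (jump X)} t :=
    hs.comp (Primrec.id.pair (Primrec.nat_add.comp (Primrec.nat_add.comp Primrec.nat_double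
      (Primrec.const c)) (Primrec.const 2))).computableIn
  have huC : ComputableIn {oracle (jump X)} u :=
    hs.comp (Primrec.snd.pair (Primrec.nat_add.comp (Primrec.nat_add.comp Primrec.snd
      Primrec.fst) (Primrec.const 2))).computableIn
  have hV := (decidableIn_haltsBy X).of_reducible (setTuringReducible_jump X)
  set U : ℕ → Set (ℕ → Bool) := fun i => {P | i ∈ relCE (join X P) i} with hU
  set K : Set (ℕ → Bool) := paths T ∩ {P | ∀ i, P ∈ U i → HaltsBy X i (t i) P} with hK
  -- A prefix length at which the whole `n`-th approximation is determined.
  obtain ⟨M, hMC, hM⟩ : ∃ M : ℕ → ℕ, ComputableIn {oracle (jump X)} M ∧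
      ∀ n, L (n + 1) ≤ M n ∧ ∀ i < n, u (n, i) ≤ M n ∧ t i ≤ M n := by
    have hd : DecidableIn (jump X) fun q : ℕ × ℕ =>
        L (q.1 + 1) ≤ q.2 ∧ ∀ i < q.1, u (q.1, i) ≤ q.2 ∧ t i ≤ q.2 := by
      refine (DecidableIn.le (hL.comp (Primrec.succ.comp Primrec.fst).computableIn)
        ComputableIn.snd).and (DecidableIn.forall_lt (p := fun r : (ℕ × ℕ) × ℕ =>
          u (r.1.1, r.2) ≤ r.1.2 ∧ t r.2 ≤ r.1.2) ?_ ComputableIn.fst)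
      have h2 : ComputableIn {oracle (jump X)} fun r : (ℕ × ℕ) × ℕ => r.1.2 :=
        (Primrec.snd.comp Primrec.fst).computableIn
      exact (DecidableIn.le (huC.comp ((Primrec.fst.comp Primrec.fst).pair
        Primrec.snd).computableIn) h2).and (DecidableIn.le (htC.comp ComputableIn.snd) h2)
    refine hd.exists_search fun n => ?_
    refine ⟨max (L (n + 1)) ((Finset.range n).sup fun i => max (u (n, i)) (t i)),
      le_max_left _ _, fun i hi => ?_⟩
    have := Finset.le_sup (f := fun i => max (u (n, i)) (t i)) (Finset.mem_range.2 hi)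
    exact ⟨(le_max_left _ _).trans (this.trans (le_max_right _ _)),
      (le_max_right _ _).trans (this.trans (le_max_right _ _))⟩
  set Q : ℕ × List Bool → Prop := fun q => q.2.take (L (q.1 + 1)) ∈ T ∧
    ∀ i < q.1, HaltsBy X i (u (q.1, i)) (extend q.2) → HaltsBy X i (t i) (extend q.2) with hQ
  have hQd : DecidableIn (jump X) Q := by
    refine (hT.comp (ComputableIn.of_primrec_comp₂ Primrec.list_take
      (hL.comp (Primrec.succ.comp Primrec.fst).computableIn) ComputableIn.snd)).and
      (DecidableIn.forall_lt (p := fun r : (ℕ × List Bool) × ℕ =>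
        HaltsBy X r.2 (u (r.1.1, r.2)) (extend r.1.2) → HaltsBy X r.2 (t r.2) (extend r.1.2)) ?_
        ComputableIn.fst)
    have h1 : ComputableIn {oracle (jump X)} fun r : (ℕ × List Bool) × ℕ => r.1.2 :=
      (Primrec.snd.comp Primrec.fst).computableIn
    exact (hV.comp ((ComputableIn.snd.pair (huC.comp ((Primrec.fst.comp Primrec.fst).pair
      Primrec.snd).computableIn)).pair h1)).imp
      (hV.comp ((ComputableIn.snd.pair (htC.comp ComputableIn.snd)).pair h1))
  have hQiff : ∀ n P, Q (n, initSeg P (M n)) ↔ initSeg P (L (n + 1)) ∈ T ∧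
      ∀ i < n, HaltsBy X i (u (n, i)) P → HaltsBy X i (t i) P := fun n P => by
    refine and_congr (by rw [take_initSeg P (hM n).1]) (forall₂_congr fun i hi => imp_congr ?_ ?_)
    · exact haltsBy_congr (initSeg_extend ((hM n).2 i hi).1)
    · exact haltsBy_congr (initSeg_extend ((hM n).2 i hi).2)
  have hTK : paths T ⊆ K ∪ ⋃ i, (U i \ {P | HaltsBy X i (t i) P}) := fun P hP => by
    by_cases h : ∀ i, P ∈ U i → HaltsBy X i (t i) P
    · exact Or.inl ⟨hP, h⟩
    · push Not at h
      obtain ⟨i, hi⟩ := h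
      exact Or.inr (Set.mem_iUnion.2 ⟨i, hi⟩)
  have hKpos : 0 < coinMeasure.real K := by
    have h1 : coinMeasure.real (⋃ i, (U i \ {P | HaltsBy X i (t i) P})) ≤ (1 / 2) ^ c :=
      coinMeasure_iUnion_le fun i => (hs' i _).trans (half_pow (by omega))
    have h2 := (measureReal_mono hTK).trans (measureReal_union_le (μ := coinMeasure) _ _)
    rw [treeMeasure] at hc
    linarith
  -- Halting is witnessed by a finite prefix. A nearby `P' ∈ K` thus halts as well, hence by stage
  -- `t i`, and `P` agrees with it far enough to do the same.
  have hclosed : ∀ P, (∀ k, ∃ P' ∈ K, initSeg P' k = initSeg P k) → P ∈ K := by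
    intro P hP
    refine ⟨fun k => ?_, fun i hi => ?_⟩
    · obtain ⟨P', hP', h⟩ := hP k
      exact h ▸ hP'.1 k
    · obtain ⟨v, hv⟩ := mem_relCE_join_iff.1 hi
      obtain ⟨P', hP', h⟩ := hP (max v (t i))
      have h1 := hv.congr (initSeg_eq_of_le (le_max_left _ _) h).symm
      exact (hP'.2 i (mem_relCE_join_iff.2 ⟨_, h1⟩)).congr
        (initSeg_eq_of_le (le_max_right _ _) h)
  have herr : ∀ n, coinMeasure.real ({P | Q (n, initSeg P (M n))} \ K) ≤ (1 / 2) ^ n := by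
    intro n
    -- A path in the approximation but outside `K` violates some condition `i`: if `i < n` it enters
    -- `U i` after `u (n, i)`, otherwise after `t i`. Both cases cost at most `2^-(i+n+2)`, in total
    -- `2^-(n+1)`; the tree contributes another `2^-(n+1)`.
    set w : ℕ → ℕ := fun i => if i < n then u (n, i) else t i with hw
    have hsub : {P | Q (n, initSeg P (M n))} \ K ⊆
        ({P | initSeg P (L (n + 1)) ∈ T} \ paths T) ∪ ⋃ i, (U i \ {P | HaltsBy X i (w i) P}) := by
      rintro P ⟨h1, h2⟩
      obtain ⟨h1, h3⟩ := (hQiff n P).1 h1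
      by_cases hP : P ∈ paths T
      · refine Or.inr (Set.mem_iUnion.2 ?_)
        by_contra! hne
        refine h2 ⟨hP, fun i hi => ?_⟩
        have h4 : HaltsBy X i (w i) P := by
          by_contra h4
          exact hne i ⟨hi, h4⟩
        by_cases hin : i < n
        · simp only [hw, if_pos hin] at h4
          exact h3 i hin h4
        · simpa only [hw, if_neg hin] using h4
      · exact Or.inl ⟨h1, hP⟩
    have h1 : coinMeasure.real (⋃ i, (U i \ {P | HaltsBy X i (w i) P})) ≤ (1 / 2) ^ (n + 1) := by
      refine coinMeasure_iUnion_le fun i => ?_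
      by_cases hin : i < n
      · simp only [hw, if_pos hin]
        exact (hs' i _).trans (half_pow (by omega))
      · simp only [hw, if_neg hin]
        exact (hs' i _).trans (half_pow (by omega))
    have h2 := (measureReal_mono hsub).trans (measureReal_union_le (μ := coinMeasure) _ _)
    have h3 := hε (n + 1)
    have h4 : (1 / 2 : ℝ) ^ (n + 1) = (1 / 2) ^ n / 2 := by ring
    linarith
  obtain ⟨P, hPK, hPC⟩ := exists_computableIn_mem hclosed hKpos hQd hMC
    (fun n P hP => (hQiff n P).2 ⟨hP.1 _, fun i _ h => hP.2 i (mem_relCE_join_iff.2 ⟨_, h⟩)⟩) herr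
  refine ⟨P, hPK.1, DecidableIn.setTuringReducible ?_⟩
  -- To decide whether `i` is in the jump, run the program to stage `t i` on the computed prefix of
  -- `P`.
  refine (hV.comp ((ComputableIn.id.pair htC).pair
    (ComputableIn.comp ((computableIn_initSeg P).of_reducible (setTuringReducible_iff.2 hPC))
      htC))).of_iff fun i => ?_
  rw [jump_eq_true_iff]
  refine (haltsBy_congr (initSeg_extend le_rfl)).trans
    ⟨fun h => mem_relCE_join_iff.2 ⟨_, h⟩, hPK.2 i⟩

/-! ## Trees of computable measure -/

theorem paths_subset_level (T : Set (List Bool)) (l : ℕ) : paths T ⊆ {P | initSeg P l ∈ T} :=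
  fun _ hP => hP l

theorem measurableSet_paths (T : Set (List Bool)) : MeasurableSet (paths T) := by
  have : paths T = ⋂ n, {P | initSeg P n ∈ T} := by ext P; simp [paths]
  rw [this]
  exact MeasurableSet.iInter fun n => measurableSet_initSeg (fun τ => τ ∈ T) n

theorem tendsto_coinMeasure_level {T : Set (List Bool)} (hT : IsBinaryTree T) :
    Tendsto (fun l => coinMeasure.real {P | initSeg P l ∈ T}) atTop (nhds (treeMeasure T)) := by
  have hpaths : paths T = ⋂ n, {P | initSeg P n ∈ T} := by ext P; simp [paths]
  have hanti : Antitone fun l => {P | initSeg P l ∈ T} := fun l m h P hP =>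
    hT _ _ (by rw [← take_initSeg P h]; exact List.take_prefix _ _) hP
  have := tendsto_measure_iInter_atTop (μ := coinMeasure)
    (fun l => (measurableSet_initSeg (fun τ => τ ∈ T) l).nullMeasurableSet) hanti
    ⟨0, measure_ne_top _ _⟩
  rw [← hpaths] at this
  exact (ENNReal.tendsto_toReal (measure_ne_top coinMeasure _)).comp this

/-- The levels of a decidable tree of computable measure approximate it effectively. -/
theorem exists_level_approx {A : ℕ → Bool} {T : Set (List Bool)} (hT : IsBinaryTree T)
    (hTd : DecidableIn A fun σ => σ ∈ T) (hr : RealComputableIn A (treeMeasure T)) :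
    ∃ L : ℕ → ℕ, ComputableIn {oracle A} L ∧
      ∀ n, coinMeasure.real ({P | initSeg P (L n) ∈ T} \ paths T) ≤ (1 / 2) ^ n := by
  obtain ⟨a, b, ha, hb, hab⟩ := hr
  -- With `q` the dyadic approximation of `μ(T)` at precision `n + 2`, this tests whether the level
  -- has measure at most `q + 2 * 2^-(n+2)`; `b` stands on the left to avoid natural subtraction.
  -- Some level passes because `μ(T) ≤ q + 2^-(n+2)`, and its excess is at most `3 * 2^-(n+2) ≤
  -- 2^-n`.
  have hd : DecidableIn A fun q : ℕ × ℕ =>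
      countStrings (fun τ => τ ∈ T) q.2 * 2 ^ (q.1 + 2) + b (q.1 + 2) * 2 ^ q.2 ≤
        (a (q.1 + 2) + 2) * 2 ^ q.2 := by
    have hn : ComputableIn {oracle A} fun q : ℕ × ℕ => q.1 + 2 :=
      (Primrec.nat_add.comp Primrec.fst (Primrec.const 2)).computableIn
    have hc : ComputableIn {oracle A} fun q : ℕ × ℕ => countStrings (fun τ => τ ∈ T) q.2 :=
      computableIn_countStrings (p := fun r : (ℕ × ℕ) × List Bool => r.2 ∈ T)
        (hTd.comp ComputableIn.snd) ComputableIn.snd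
    exact DecidableIn.le ((hc.mul hn.two_pow).add ((hb.comp hn).mul ComputableIn.snd.two_pow))
      (((ha.comp hn).add (ComputableIn.const 2)).mul ComputableIn.snd.two_pow)
  have hiff : ∀ n l, countStrings (fun τ => τ ∈ T) l * 2 ^ (n + 2) + b (n + 2) * 2 ^ l ≤
      (a (n + 2) + 2) * 2 ^ l ↔ coinMeasure.real {P | initSeg P l ∈ T} ≤
        ((a (n + 2) : ℝ) - b (n + 2)) / 2 ^ (n + 2) + 2 * (2 ^ (n + 2))⁻¹ := by
    intro n l
    rw [coinMeasure_initSeg (fun τ => τ ∈ T), ← div_eq_mul_inv, ← add_div,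
      div_le_div_iff₀ (by positivity) (by positivity), ← Nat.cast_le (α := ℝ)]
    push_cast
    constructor <;> intro h <;> linarith
  obtain ⟨L, hL, hL'⟩ := hd.exists_search fun n => by
    have hpos : (0 : ℝ) < (2 ^ (n + 2))⁻¹ := by positivity
    have hlt : treeMeasure T < ((a (n + 2) : ℝ) - b (n + 2)) / 2 ^ (n + 2) +
        2 * (2 ^ (n + 2))⁻¹ := by
      have := (abs_le.1 (hab (n + 2))).2
      linarith
    obtain ⟨l, hl⟩ := ((tendsto_coinMeasure_level hT).eventually_lt_const hlt).exists
    exact ⟨l, (hiff n l).2 hl.le⟩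
  refine ⟨L, hL, fun n => ?_⟩
  rw [measureReal_sdiff (paths_subset_level T _) (measurableSet_paths T)]
  have h1 := (hiff n _).1 (hL' n)
  have h2 := (abs_le.1 (hab (n + 2))).1
  have h3 : (1 / 2 : ℝ) ^ n = 4 * (2 ^ (n + 2))⁻¹ := by
    rw [one_div, inv_pow, pow_add, mul_inv]; norm_num; ring
  have h4 : (0 : ℝ) < (2 ^ (n + 2))⁻¹ := by positivity
  rw [treeMeasure] at h2
  linarith

theorem exists_low_path {X : ℕ → Bool} {T : Set (List Bool)} (hT : IsBinaryTree T)
    (hTd : SetComputableIn (jump X) T) (hpos : 0 < treeMeasure T)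
    (hr : RealComputableIn (jump X) (treeMeasure T)) : ∃ P ∈ paths T, LowOver X P := by
  have hTd' := setComputableIn_iff.1 hTd
  obtain ⟨L, hL, hε⟩ := exists_level_approx hT hTd' hr
  exact exists_path_lowOver hTd' hpos hL hε

/-! ## Sequences avoiding a relation -/

theorem length_binaryStrings (n : ℕ) : (binaryStrings n).length = 2 ^ n := by
  induction n with
  | zero => rfl
  | succ n ih => simp [binaryStrings, List.length_flatMap, ih, pow_succ]

theorem countStrings_le_two_pow {p : List Bool → Prop} {m n : ℕ} (h : m ≤ n)
    (hp : ∀ σ τ : List Bool, σ.length = n → τ.length = n → p σ → p τ →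
      σ.take m = τ.take m → σ = τ) :
    countStrings p n ≤ 2 ^ m := by
  classical
  have hcard : countStrings p n =
      ((binaryStrings n).filter fun σ => decide (p σ)).toFinset.card := by
    rw [countStrings, List.countP_eq_length_filter,
      ← List.toFinset_card_of_nodup ((nodup_binaryStrings n).filter _)]
  rw [hcard, ← length_binaryStrings m, ← List.toFinset_card_of_nodup (nodup_binaryStrings m)]
  refine Finset.card_le_card_of_injOn (List.take m) (fun σ hσ => ?_) fun σ hσ τ hτ => ?_
  · have : σ.length = n ∧ p σ := by simpa [mem_binaryStrings] using hσ
    simp [mem_binaryStrings, this.1, h]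
  · have h1 : σ.length = n ∧ p σ := by simpa [mem_binaryStrings] using hσ
    have h2 : τ.length = n ∧ p τ := by simpa [mem_binaryStrings] using hτ
    exact hp σ τ h1.1 h2.1 h1.2 h2.2

/-- Each prefix of length `m` is related to at most one string of length `n`, so truncation to `m`
digits is injective on the bad strings. -/
theorem coinMeasure_rel_initSeg_le {R : ℕ × ℕ → Prop} (hR : ∀ x y z, R (x, y) → R (x, z) → y = z)
    {m n : ℕ} (h : m ≤ n) :
    coinMeasure.real {P | R (Encodable.encode (initSeg P m), Encodable.encode (initSeg P n))} ≤
      2 ^ m / 2 ^ n := by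
  have h1 : {P | R (Encodable.encode (initSeg P m), Encodable.encode (initSeg P n))} =
      {P | R (Encodable.encode ((initSeg P n).take m), Encodable.encode (initSeg P n))} := by
    ext P; rw [Set.mem_ofPred_eq, Set.mem_ofPred_eq, take_initSeg P h]
  rw [h1, coinMeasure_initSeg (fun τ => R (Encodable.encode (τ.take m), Encodable.encode τ))]
  refine div_le_div_of_nonneg_right ?_ (by positivity)
  exact_mod_cast countStrings_le_two_pow h fun σ τ _ _ hσ hτ hst =>
    Encodable.encode_injective (hR _ _ _ hσ (by rw [hst]; exact hτ))

/-- If each number is related to at most one number, and the relation is decidable in `X'`, then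
some set low over `X` computes an infinite sequence no member of which is related to a later one. -/
theorem exists_low_avoiding {X : ℕ → Bool} {R : ℕ × ℕ → Prop} (hRd : DecidableIn (jump X) R)
    (hR : ∀ x y z, R (x, y) → R (x, z) → y = z) :
    ∃ (P : ℕ → Bool) (d : ℕ → ℕ), LowOver X P ∧ ComputableIn {oracle P} d ∧
      Function.Injective d ∧ ∀ i n, i < n → ¬ R (d i, d n) := by
  -- Chosen so that `l n - l (n - 1) = 2n + 1`: each `i < n` contributes at most `2^-(2n+1)` to `B
  -- n`, hence `μ(B n) ≤ n * 2^-(2n+1) ≤ 2^-(n+1)`.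
  set l : ℕ → ℕ := fun n => n * (n + 2) with hl
  have hlC : Primrec l := Primrec.nat_mul.comp Primrec.id
    (Primrec.nat_add.comp Primrec.id (Primrec.const 2))
  have hlmono : StrictMono l := fun m n h => Nat.mul_lt_mul'' h (by omega)
  have hnl : ∀ n, n ≤ l n := fun _ => hlmono.le_apply
  -- Since `n ≤ l n`, the bound on `n` excludes no relevant case and keeps membership decidable.
  set T : Set (List Bool) := {σ | ∀ n < σ.length + 1, ∀ i < n, l n ≤ σ.length →
    ¬ R (Encodable.encode (σ.take (l i)), Encodable.encode (σ.take (l n)))} with hT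
  set B : ℕ → Set (ℕ → Bool) := fun n => {P | ∃ i < n,
    R (Encodable.encode (initSeg P (l i)), Encodable.encode (initSeg P (l n)))} with hB
  have hTB : ∀ P m, initSeg P m ∈ T ↔ ∀ n, l n ≤ m → P ∉ B n := by
    intro P m
    simp only [hT, hB, Set.mem_ofPred_eq, length_initSeg, not_exists, not_and]
    refine ⟨fun h n hn i hi => ?_, fun h n _ i hi hn => ?_⟩
    · have := h n (Nat.lt_succ_of_le ((hnl n).trans hn)) i hi hn
      rwa [take_initSeg P hn, take_initSeg P ((hlmono hi).le.trans hn)] at this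
    · rw [take_initSeg P hn, take_initSeg P ((hlmono hi).le.trans hn)]
      exact h n hn i hi
  have hTd : DecidableIn (jump X) fun σ => σ ∈ T := by
    refine DecidableIn.forall_lt (p := fun q : List Bool × ℕ => ∀ i < q.2, l q.2 ≤ q.1.length →
        ¬ R (Encodable.encode (q.1.take (l i)), Encodable.encode (q.1.take (l q.2))))
      (DecidableIn.forall_lt (p := fun r : (List Bool × ℕ) × ℕ => l r.1.2 ≤ r.1.1.length →
        ¬ R (Encodable.encode (r.1.1.take (l r.2)), Encodable.encode (r.1.1.take (l r.1.2))))
        ?_ ComputableIn.snd) (Primrec.succ.comp Primrec.list_length).computableIn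
    have h1 : Primrec fun r : (List Bool × ℕ) × ℕ => r.1.1 := Primrec.fst.comp Primrec.fst
    have h2 : Primrec fun r : (List Bool × ℕ) × ℕ => l r.1.2 :=
      hlC.comp (Primrec.snd.comp Primrec.fst)
    have h3 : Primrec fun r : (List Bool × ℕ) × ℕ => l r.2 := hlC.comp Primrec.snd
    exact (DecidableIn.le h2.computableIn (Primrec.list_length.comp h1).computableIn).imp
      (hRd.comp (Primrec.pair (Primrec.encode.comp (Primrec.list_take.comp h3 h1))
        (Primrec.encode.comp (Primrec.list_take.comp h2 h1))).computableIn).not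
  have hBμ : ∀ n, coinMeasure.real (B n) ≤ (1 / 2) ^ (n + 1) := by
    intro n
    have h1 : B n = ⋃ i ∈ Finset.range n, {P | R (Encodable.encode (initSeg P (l i)),
        Encodable.encode (initSeg P (l n)))} := by
      ext P; simp [hB]
    have h2 : ∀ i ∈ Finset.range n, coinMeasure.real {P | R (Encodable.encode (initSeg P (l i)),
        Encodable.encode (initSeg P (l n)))} ≤ (1 / 2) ^ (2 * n + 1) := by
      intro i hi
      have hin : i + 1 ≤ n := Finset.mem_range.1 hi
      have hle : l i + (2 * n + 1) ≤ l n := by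
        obtain ⟨k, rfl⟩ := Nat.exists_eq_add_of_le hin
        simp only [hl]
        nlinarith
      refine (coinMeasure_rel_initSeg_le hR (hlmono hin).le).trans ?_
      rw [one_div, inv_pow, div_le_iff₀ (by positivity), inv_mul_eq_div, le_div_iff₀ (by positivity),
        ← pow_add]
      exact pow_le_pow_right₀ (by norm_num) hle
    rw [h1]
    refine (measureReal_biUnion_finset_le _ _).trans ((Finset.sum_le_card_nsmul _ _ _ h2).trans ?_)
    rw [Finset.card_range, nsmul_eq_mul, show (1 / 2 : ℝ) ^ (2 * n + 1) =
      (1 / 2) ^ (n + 1) * (1 / 2) ^ n by ring]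
    have h3 : (n : ℝ) * (1 / 2) ^ n ≤ 1 := by
      rw [one_div, inv_pow, ← div_eq_mul_inv, div_le_one (by positivity)]
      exact_mod_cast Nat.lt_two_pow_self.le
    have h4 : (0 : ℝ) < (1 / 2) ^ (n + 1) := by positivity
    nlinarith
  have hpaths : ∀ P, P ∈ paths T ↔ ∀ n, P ∉ B n := fun P =>
    ⟨fun h n => (hTB P (l n)).1 (h _) n le_rfl, fun h m => (hTB P m).2 fun n _ => h n⟩
  have hpos : 0 < treeMeasure T := by
    -- `B 0` is empty, so the bad events have total measure at most `1/2`.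
    have h1 : Set.univ ⊆ paths T ∪ ⋃ j, B (j + 1) := fun P _ => by
      by_cases h : P ∈ paths T
      · exact Or.inl h
      · rw [hpaths] at h
        push Not at h
        obtain ⟨n, hn⟩ := h
        cases n with
        | zero => simp [hB] at hn
        | succ n => exact Or.inr (Set.mem_iUnion.2 ⟨n, hn⟩)
    have h2 := (measureReal_mono h1).trans (measureReal_union_le (μ := coinMeasure) _ _)
    have h3 : coinMeasure.real (⋃ j, B (j + 1)) ≤ (1 / 2) ^ 1 :=
      coinMeasure_iUnion_le fun i => hBμ _
    rw [probReal_univ] at h2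
    rw [treeMeasure]
    linarith
  have herr : ∀ n, coinMeasure.real ({P | initSeg P (l n) ∈ T} \ paths T) ≤ (1 / 2) ^ n := by
    intro N
    have h1 : {P | initSeg P (l N) ∈ T} \ paths T ⊆ ⋃ j, B (j + N + 1) := by
      rintro P ⟨h1, h2⟩
      have h1 : initSeg P (l N) ∈ T := h1
      rw [hTB] at h1
      rw [hpaths] at h2
      push Not at h2
      obtain ⟨n, hn⟩ := h2
      have hNn : N < n := by
        by_contra h
        exact h1 n (hlmono.monotone (not_lt.1 h)) hn
      obtain ⟨k, rfl⟩ := Nat.exists_eq_add_of_le (Nat.succ_le_of_lt hNn)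
      exact Set.mem_iUnion.2 ⟨k, by rwa [show k + N + 1 = N.succ + k by omega]⟩
    refine (measureReal_mono h1).trans (coinMeasure_iUnion_le fun i => (hBμ _).trans ?_)
    exact pow_le_pow_of_le_one (by norm_num) (by norm_num) (by omega)
  -- The levels `l n` already have explicit error bounds, so computability of `μ(T)` need not be
  -- shown separately.
  obtain ⟨P, hP, hlow⟩ := exists_path_lowOver hTd hpos hlC.computableIn herr
  refine ⟨P, fun n => Encodable.encode (initSeg P (l n)), hlow,
    ComputableIn.of_primrec_comp Primrec.encode ((computableIn_initSeg P).comp hlC.computableIn),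
    fun m n h => ?_, fun i n hi h => (hpaths P).1 hP n ⟨i, hi, h⟩⟩
  have := congrArg List.length (Encodable.encode_injective h)
  exact hlmono.injective (by simpa using this)

/-! ## Rainbows for stable colorings -/

/-- In the limit, `x` and `y` receive the same colors. -/
def Partner (f : ℕ → ℕ → ℕ) (x y : ℕ) : Prop := x ≠ y ∧ ∀ᶠ s in atTop, f x s = f y s

theorem Partner.symm {f : ℕ → ℕ → ℕ} {x y : ℕ} (h : Partner f x y) : Partner f y x :=
  ⟨h.1.symm, h.2.mono fun _ => Eq.symm⟩

theorem TwoBounded.eq_of_eq {f : ℕ → ℕ → ℕ} (hf : TwoBounded f) {x y z s : ℕ} (hx : x < s)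
    (hy : y < s) (hz : z < s) (hxy : x ≠ y) (hxz : x ≠ z) (h₁ : f x s = f y s)
    (h₂ : f x s = f z s) : y = z := by
  by_contra hyz
  have hsub : ({(x, s), (y, s), (z, s)} : Set (ℕ × ℕ)) ⊆
      {p : ℕ × ℕ | p.1 < p.2 ∧ f p.1 p.2 = f x s} := by
    rintro p (rfl | rfl | rfl)
    · exact ⟨hx, rfl⟩
    · exact ⟨hy, h₁.symm⟩
    · exact ⟨hz, h₂.symm⟩
  have h3 : ({(x, s), (y, s), (z, s)} : Set (ℕ × ℕ)).encard = 3 := by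
    rw [Set.encard_insert_of_notMem (by simp [hxy, hxz]), Set.encard_pair (by simp [hyz])]
    rfl
  have := (Set.encard_le_encard hsub).trans (hf (f x s))
  rw [h3] at this
  exact absurd this (by decide)

theorem TwoBounded.partner_unique {f : ℕ → ℕ → ℕ} (hf : TwoBounded f) {x y z : ℕ}
    (hy : Partner f x y) (hz : Partner f x z) : y = z := by
  obtain ⟨s, h1, h2, h3, h4, h5⟩ := (hy.2.and (hz.2.and ((eventually_gt_atTop x).and
    ((eventually_gt_atTop y).and (eventually_gt_atTop z))))).exists
  exact hf.eq_of_eq h3 h4 h5 hy.1 hz.1 h1 h2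

/-- If `x` has a limit partner `z`, then `f x s = f y s` at one large `s` forces `y = z` by
2-boundedness. So equality of colors converges for every pair, which makes `Partner` decidable in
the jump. -/
theorem RainbowStable.eventually_ne {f : ℕ → ℕ → ℕ} (hs : RainbowStable f) (hf : TwoBounded f)
    {x y : ℕ} (hxy : x ≠ y) (h : ¬ Partner f x y) : ∀ᶠ s in atTop, f x s ≠ f y s := by
  rcases hs x with ⟨z, hz, hxz⟩ | hx
  · filter_upwards [hxz, eventually_gt_atTop x, eventually_gt_atTop y, eventually_gt_atTop z]
      with s h1 h2 h3 h4 h5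
    obtain rfl := hf.eq_of_eq h2 h3 h4 hxy hz.symm h5 h1
    exact h ⟨hxy, hxz⟩
  · filter_upwards [hx, eventually_gt_atTop y] with s h1 h2 h3
    exact h1 y h2 hxy.symm h3

theorem TwoBounded.eventually_ne {f : ℕ → ℕ → ℕ} (hf : TwoBounded f) (x c : ℕ) :
    ∀ᶠ s in atTop, f x s ≠ c := by
  have hfin : {p : ℕ × ℕ | p.1 < p.2 ∧ f p.1 p.2 = c}.Finite :=
    Set.finite_of_encard_le_coe (k := 2) (hf c)
  obtain ⟨N, hN⟩ := (hfin.image Prod.snd).bddAbove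
  filter_upwards [eventually_gt_atTop N, eventually_gt_atTop x] with s h1 h2 h3
  exact absurd (hN ⟨(x, s), ⟨h2, h3⟩, rfl⟩) (not_le.2 h1)

/-- The graph records only increasing pairs. For `x ≥ y` the search condition is vacuous and the
value of `g` carries no information. -/
theorem exists_computableIn_coloring {X : ℕ → Bool} {f : ℕ → ℕ → ℕ}
    (hf : SetTuringReducible (coloringGraph f) X) :
    ∃ g : ℕ × ℕ → ℕ, ComputableIn {oracle X} g ∧ ∀ x y, x < y → g (x, y) = f x y := by
  have hd : DecidableIn X fun q : (ℕ × ℕ) × ℕ => q.1.1 < q.1.2 →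
      coloringGraph f (Nat.pair (Nat.pair q.1.1 q.1.2) q.2) = true := by
    have h1 : Primrec fun q : (ℕ × ℕ) × ℕ => q.1.1 := Primrec.fst.comp Primrec.fst
    have h2 : Primrec fun q : (ℕ × ℕ) × ℕ => q.1.2 := Primrec.snd.comp Primrec.fst
    exact (DecidableIn.lt h1.computableIn h2.computableIn).imp
      (((decidableIn_oracle _).of_reducible hf).comp (Primrec₂.natPair.comp
        (Primrec₂.natPair.comp h1 h2) Primrec.snd).computableIn)
  have hiff : ∀ x y z, x < y →
      (coloringGraph f (Nat.pair (Nat.pair x y) z) = true ↔ z = f x y) := by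
    intro x y z hxy
    simp only [coloringGraph, decide_eq_true_eq, Nat.pair_eq_pair]
    constructor
    · rintro ⟨x', y', -, ⟨rfl, rfl⟩, h⟩
      exact h
    · exact fun h => ⟨x, y, hxy, ⟨rfl, rfl⟩, h⟩
  obtain ⟨g, hg, hg'⟩ := hd.exists_search fun ⟨x, y⟩ =>
    ⟨f x y, fun h => (hiff x y _ h).2 rfl⟩
  exact ⟨g, hg, fun x y h => (hiff x y _ h).1 (hg' (x, y) h)⟩

theorem decidableIn_partner {X : ℕ → Bool} {f : ℕ → ℕ → ℕ}
    (hX : SetTuringReducible (coloringGraph f) X) (hs : RainbowStable f) (hf : TwoBounded f) :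
    DecidableIn (jump X) fun q : ℕ × ℕ => Partner f q.1 q.2 := by
  obtain ⟨g, hg, hgf⟩ := exists_computableIn_coloring hX
  have heq : ∀ x y, ∀ᶠ s in atTop, (x ≠ y ∧ g (x, s) = g (y, s)) ↔ (x ≠ y ∧ f x s = f y s) := by
    intro x y
    filter_upwards [eventually_gt_atTop x, eventually_gt_atTop y] with s h1 h2
    rw [hgf x s h1, hgf y s h2]
  have hd : DecidableIn X fun r : (ℕ × ℕ) × ℕ =>
      r.1.1 ≠ r.1.2 ∧ g (r.1.1, r.2) = g (r.1.2, r.2) := by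
    have h1 : ComputableIn {oracle X} fun r : (ℕ × ℕ) × ℕ => r.1.1 :=
      (Primrec.fst.comp Primrec.fst).computableIn
    have h2 : ComputableIn {oracle X} fun r : (ℕ × ℕ) × ℕ => r.1.2 :=
      (Primrec.snd.comp Primrec.fst).computableIn
    exact (DecidableIn.eq h1 h2).not.and (DecidableIn.eq (hg.comp (h1.pair ComputableIn.snd))
      (hg.comp (h2.pair ComputableIn.snd)))
  refine (hd.eventually_jump fun ⟨x, y⟩ => ?_).of_iff fun ⟨x, y⟩ => ?_
  · by_cases h : Partner f x y
    · left
      filter_upwards [heq x y, h.2] with s h1 h2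
      exact h1.2 ⟨h.1, h2⟩
    · right
      by_cases hxy : x = y
      · exact Eventually.of_forall fun s h' => h'.1 hxy
      · filter_upwards [heq x y, hs.eventually_ne hf hxy h] with s h1 h2 h3
        exact h2 (h1.1 h3).2
  · rw [eventually_congr (heq x y), eventually_and, eventually_const]
    rfl

/-- A number `y` may be added to the rainbow consisting of the members of `ρ`. -/
def ExtendsRainbow (f : ℕ → ℕ → ℕ) (ρ : List ℕ) (y : ℕ) : Prop :=
  ∀ x ∈ ρ, x < y ∧ (∀ x' ∈ ρ, x ≠ x' → f x y ≠ f x' y) ∧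
    ∀ u ∈ ρ, ∀ v ∈ ρ, u < v → f x y ≠ f u v

/-- Each of the finitely many requirements holds for all large `y`: distinct non-partners eventually
receive different colors, and each old color is used only finitely often. -/
theorem eventually_extendsRainbow {f : ℕ → ℕ → ℕ} (hs : RainbowStable f) (hf : TwoBounded f)
    {ρ : List ℕ} (hρ : ∀ x ∈ ρ, ∀ y ∈ ρ, ¬ Partner f x y) :
    ∀ᶠ y in atTop, ExtendsRainbow f ρ y := by
  have hall : ∀ {p : ℕ → ℕ → Prop}, (∀ x ∈ ρ, ∀ᶠ y in atTop, p x y) →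
      ∀ᶠ y in atTop, ∀ x ∈ ρ, p x y := fun h => by
    have := (eventually_all_finset ρ.toFinset (l := atTop)).2 fun x hx => h x (by simpa using hx)
    simpa using this
  refine hall fun x hx => (eventually_gt_atTop x).and (.and (hall fun x' hx' => ?_)
    (hall fun u _ => hall fun v _ => ?_))
  · by_cases h : x = x'
    · exact Eventually.of_forall fun _ h' => (h' h).elim
    · exact (hs.eventually_ne hf h (hρ x hx x' hx')).mono fun _ h _ => h
  · exact (hf.eventually_ne x (f u v)).mono fun _ h _ => h

theorem isRainbow_of_extends {f : ℕ → ℕ → ℕ} {r : ℕ → ℕ} {R : ℕ → Bool}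
    (hr : ∀ n, ExtendsRainbow f ((List.range n).map r) (r n))
    (hR : ∀ x, R x = true ↔ ∃ n, r n = x) : IsRainbow f R := by
  have hmem : ∀ {i n}, i < n → r i ∈ (List.range n).map r := fun h =>
    List.mem_map_of_mem (List.mem_range.2 h)
  have hmono : StrictMono r := strictMono_nat_of_lt_succ fun n =>
    (hr (n + 1) (r n) (hmem n.lt_succ_self)).1
  -- By symmetry the second pair has the smaller upper end. Equal upper ends fall under the clause
  -- on new pairs, unequal ones under the clause on old colors.
  have key : ∀ a b c e, a < b → c < e → e ≤ b → f (r a) (r b) = f (r c) (r e) → a = c ∧ b = e := by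
    intro a b c e hab hce heb h
    rcases heb.eq_or_lt with rfl | hlt
    · refine ⟨?_, rfl⟩
      by_contra hac
      exact (hr e _ (hmem hab)).2.1 _ (hmem hce) (fun h' => hac (hmono.injective h')) h
    · exact ((hr b _ (hmem hab)).2.2 _ (hmem (hce.trans hlt)) _ (hmem hlt) (hmono hce) h).elim
  intro x y x' y' hx hy hx' hy' hxy hxy' h
  obtain ⟨a, rfl⟩ := (hR x).1 hx
  obtain ⟨b, rfl⟩ := (hR y).1 hy
  obtain ⟨c, rfl⟩ := (hR x').1 hx'
  obtain ⟨e, rfl⟩ := (hR y').1 hy'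
  rw [hmono.lt_iff_lt] at hxy hxy'
  rcases le_total e b with heb | heb
  · obtain ⟨rfl, rfl⟩ := key a b c e hxy hxy' heb h
    exact ⟨rfl, rfl⟩
  · obtain ⟨rfl, rfl⟩ := key c e a b hxy' hxy heb h.symm
    exact ⟨rfl, rfl⟩

theorem decidableIn_extendsRainbow {Y : ℕ → Bool} {f : ℕ → ℕ → ℕ} {g : ℕ × ℕ → ℕ}
    (hg : ComputableIn {oracle Y} g) (hgf : ∀ x y, x < y → g (x, y) = f x y) :
    DecidableIn Y fun q : List ℕ × ℕ => ExtendsRainbow f q.1 q.2 := by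
  -- The order condition is split off because `g` may replace `f` only once all pairs involved are
  -- known to be increasing.
  have hd : DecidableIn Y fun q : List ℕ × ℕ => (∀ x ∈ q.1, x < q.2) ∧
      ∀ x ∈ q.1, (∀ x' ∈ q.1, x ≠ x' → g (x, q.2) ≠ g (x', q.2)) ∧
        ∀ u ∈ q.1, ∀ v ∈ q.1, u < v → g (x, q.2) ≠ g (u, v) := by
    refine DecidableIn.and ?_ ?_
    · exact DecidableIn.forall_mem_list (p := fun r : (List ℕ × ℕ) × ℕ => r.2 < r.1.2)
        (DecidableIn.lt ComputableIn.snd (Primrec.snd.comp Primrec.fst).computableIn)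
        ComputableIn.fst
    · refine DecidableIn.forall_mem_list (p := fun r : (List ℕ × ℕ) × ℕ =>
        (∀ x' ∈ r.1.1, r.2 ≠ x' → g (r.2, r.1.2) ≠ g (x', r.1.2)) ∧
        ∀ u ∈ r.1.1, ∀ v ∈ r.1.1, u < v → g (r.2, r.1.2) ≠ g (u, v)) ?_ ComputableIn.fst
      refine DecidableIn.and ?_ ?_
      · have h1 : Primrec fun t : ((List ℕ × ℕ) × ℕ) × ℕ => t.1.2 := Primrec.snd.comp Primrec.fst
        have h2 : Primrec fun t : ((List ℕ × ℕ) × ℕ) × ℕ => t.1.1.2 :=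
          Primrec.snd.comp (Primrec.fst.comp Primrec.fst)
        exact DecidableIn.forall_mem_list (p := fun t : ((List ℕ × ℕ) × ℕ) × ℕ =>
          t.1.2 ≠ t.2 → g (t.1.2, t.1.1.2) ≠ g (t.2, t.1.1.2))
          ((DecidableIn.eq h1.computableIn ComputableIn.snd).not.imp
            (DecidableIn.eq (hg.comp (h1.pair h2).computableIn)
              (hg.comp (Primrec.snd.pair h2).computableIn)).not)
          (Primrec.fst.comp Primrec.fst).computableIn
      · refine DecidableIn.forall_mem_list (p := fun t : ((List ℕ × ℕ) × ℕ) × ℕ =>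
          ∀ v ∈ t.1.1.1, t.2 < v → g (t.1.2, t.1.1.2) ≠ g (t.2, v)) ?_
          (Primrec.fst.comp Primrec.fst).computableIn
        have h1 : Primrec fun w : (((List ℕ × ℕ) × ℕ) × ℕ) × ℕ => w.1.1.2 :=
          Primrec.snd.comp (Primrec.fst.comp Primrec.fst)
        have h2 : Primrec fun w : (((List ℕ × ℕ) × ℕ) × ℕ) × ℕ => w.1.1.1.2 :=
          Primrec.snd.comp (Primrec.fst.comp (Primrec.fst.comp Primrec.fst))
        have h3 : Primrec fun w : (((List ℕ × ℕ) × ℕ) × ℕ) × ℕ => w.1.2 :=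
          Primrec.snd.comp Primrec.fst
        exact DecidableIn.forall_mem_list (p := fun w : (((List ℕ × ℕ) × ℕ) × ℕ) × ℕ =>
          w.1.2 < w.2 → g (w.1.1.2, w.1.1.1.2) ≠ g (w.1.2, w.2))
          ((DecidableIn.lt h3.computableIn ComputableIn.snd).imp
            (DecidableIn.eq (hg.comp (h1.pair h2).computableIn)
              (hg.comp (h3.pair Primrec.snd).computableIn)).not)
          (Primrec.fst.comp (Primrec.fst.comp Primrec.fst)).computableIn
  refine hd.of_iff fun ⟨ρ, y⟩ => ?_
  have hsplit : ExtendsRainbow f ρ y ↔ _ := forall₂_and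
  refine Iff.trans (and_congr_right fun hlt => forall₂_congr fun x hx => and_congr ?_ ?_)
    hsplit.symm
  · refine forall₃_congr fun x' hx' _ => ?_
    rw [hgf _ _ (hlt x hx), hgf _ _ (hlt x' hx')]
  · refine forall₄_congr fun u _ v _ => forall_congr' fun huv => ?_
    rw [hgf _ _ (hlt x hx), hgf _ _ huv]

/-- A stable 2-bounded coloring computable in `X` has an infinite rainbow computable in `X ⊕ P`,
for some `P` that is low over `X`. -/
theorem exists_low_rainbow {X : ℕ → Bool} {f : ℕ → ℕ → ℕ}
    (hX : SetTuringReducible (coloringGraph f) X) (hf : TwoBounded f) (hs : RainbowStable f) :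
    ∃ P R, LowOver X P ∧ SetTuringReducible R (join X P) ∧ {n | R n = true}.Infinite ∧
      IsRainbow f R := by
  obtain ⟨P, d, hP, hd, hdinj, hdR⟩ := exists_low_avoiding (decidableIn_partner hX hs hf)
    fun x y z => hf.partner_unique
  have hdP : ∀ i j, ¬ Partner f (d i) (d j) := fun i j h => by
    rcases lt_trichotomy i j with hij | rfl | hij
    · exact hdR i j hij h
    · exact h.1 rfl
    · exact hdR j i hij h.symm
  obtain ⟨g, hg, hgf⟩ := exists_computableIn_coloring hX
  have hg := hg.of_reducible (left_le_join X P)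
  have hd := hd.of_reducible (right_le_join X P)
  have hext := decidableIn_extendsRainbow hg hgf
  -- The greedy step works with indices into `d`. Injectivity makes `d` tend to infinity, so some
  -- index meets the eventual condition.
  obtain ⟨next, hnext, hnext'⟩ : ∃ next : List ℕ → ℕ, ComputableIn {oracle (join X P)} next ∧
      ∀ κ : List ℕ, ExtendsRainbow f (κ.map d) (d (next κ)) := by
    have hmap : ComputableIn {oracle (join X P)} fun κ : List ℕ => κ.map d := by
      have hget : ComputableIn {oracle (join X P)} fun q : List ℕ × ℕ => d (q.1.getD q.2 0) :=
        hd.comp (Primrec.list_getD 0).computableIn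
      refine (ComputableIn.list_map_range (f := fun (κ : List ℕ) i => d (κ.getD i 0)) hget
        Primrec.list_length.computableIn).of_eq fun κ => ?_
      refine List.ext_getElem (by simp) fun i h₁ h₂ => ?_
      have : i < κ.length := by simpa using h₂
      simp [this]
    refine DecidableIn.exists_search (p := fun q : List ℕ × ℕ =>
      ExtendsRainbow f (q.1.map d) (d q.2)) (hext.comp ((hmap.comp ComputableIn.fst).pair
        (hd.comp ComputableIn.snd))) fun κ => ?_
    have h : ∀ᶠ y in atTop, ExtendsRainbow f (κ.map d) y := by
      refine eventually_extendsRainbow hs hf ?_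
      simp only [List.mem_map]
      rintro _ ⟨i, -, rfl⟩ _ ⟨j, -, rfl⟩
      exact hdP i j
    exact (hdinj.nat_tendsto_atTop.eventually h).exists
  set S : ℕ → List ℕ := fun k => Nat.rec [] (fun _ κ => κ ++ [next κ]) k with hS
  have hSC : ComputableIn {oracle (join X P)} S :=
    ComputableIn.nat_rec (h := fun q : (ℕ × ℕ) × List ℕ => q.2 ++ [next q.2]) ComputableIn.id
      (ComputableIn.const []) (ComputableIn.of_primrec_comp₂
        (f := fun (l : List ℕ) (x : ℕ) => l ++ [x]) Primrec.list_concat ComputableIn.snd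
        (hnext.comp ComputableIn.snd))
  set r : ℕ → ℕ := fun n => d (next (S n)) with hr
  have hSr : ∀ n, (S n).map d = (List.range n).map r := fun n => by
    induction n with
    | zero => rfl
    | succ n ih =>
      rw [show S (n + 1) = S n ++ [next (S n)] from rfl, List.range_succ, List.map_append,
        List.map_append, ih]
      rfl
  have hrext : ∀ n, ExtendsRainbow f ((List.range n).map r) (r n) := fun n => by
    rw [← hSr]
    exact hnext' (S n)
  have hmono : StrictMono r := strictMono_nat_of_lt_succ fun n =>
    (hrext (n + 1) (r n) (List.mem_map_of_mem (List.mem_range.2 n.lt_succ_self))).1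
  classical
  set R : ℕ → Bool := fun x => decide (∃ n, r n = x) with hR
  refine ⟨P, R, hP, DecidableIn.setTuringReducible ?_, ?_,
    isRainbow_of_extends hrext (by simp [hR])⟩
  · have hrC : ComputableIn {oracle (join X P)} r := hd.comp (hnext.comp hSC)
    refine (DecidableIn.exists_lt (p := fun q : ℕ × ℕ => r q.2 = q.1)
      (DecidableIn.eq (hrC.comp ComputableIn.snd) ComputableIn.fst)
      Primrec.succ.computableIn).of_iff fun x => ?_
    simp only [hR, decide_eq_true_eq]
    -- The range of `r` is decidable because `n ≤ r n`: only indices up to `x` can produce `x`.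
    exact ⟨fun ⟨n, _, h⟩ => ⟨n, h⟩,
      fun ⟨n, h⟩ => ⟨n, Nat.lt_succ_of_le (h ▸ hmono.le_apply), h⟩⟩
  · have : {n | R n = true} = Set.range r := by ext x; simp [hR]
    rw [this]
    exact Set.infinite_range_of_injective hmono.injective

/-! ## A model containing only low sets -/

theorem SetTuringReducible.exists_relCE {A B : ℕ → Bool} (h : SetTuringReducible A B) :
    ∃ e, relCE B e = {n | A n = true} := by
  -- The test does not depend on the search variable: the search stops at once if `n ∈ A` and never
  -- otherwise.
  refine (ce_iff B _).1 ⟨fun n => Nat.rfind fun _ => Part.some (A n), ?_, ?_⟩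
  · exact RecursiveIn.rfind (p := fun n _ => A n)
      ((setTuringReducible_iff.1 h).comp ComputableIn.fst)
  · ext n
    refine (Nat.rfind_dom (p := fun _ => Part.some (A n))).trans ?_
    simp

theorem countable_setTuringReducible (B : ℕ → Bool) : {A | SetTuringReducible A B}.Countable := by
  classical
  refine (Set.countable_range fun e n => decide (n ∈ relCE B e)).mono fun A hA => ?_
  obtain ⟨e, he⟩ := SetTuringReducible.exists_relCE hA
  exact ⟨e, funext fun n => by simp [he]⟩

theorem coloringGraph_inj {f g : ℕ → ℕ → ℕ} (h : coloringGraph f = coloringGraph g) {x y : ℕ}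
    (hxy : x < y) : f x y = g x y := by
  have h1 : coloringGraph f (Nat.pair (Nat.pair x y) (f x y)) = true := by
    simp only [coloringGraph, decide_eq_true_eq]
    exact ⟨x, y, hxy, rfl⟩
  rw [h] at h1
  simp only [coloringGraph, decide_eq_true_eq, Nat.pair_eq_pair] at h1
  obtain ⟨x', y', -, ⟨rfl, rfl⟩, h1⟩ := h1
  exact h1

theorem IsRainbow.of_coloringGraph_eq {f g : ℕ → ℕ → ℕ} {R : ℕ → Bool} (hf : IsRainbow f R)
    (h : coloringGraph f = coloringGraph g) : IsRainbow g R := by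
  intro x y x' y' hx hy hx' hy' hxy hxy' hg
  refine hf x y x' y' hx hy hx' hy' hxy hxy' ?_
  rw [coloringGraph_inj h hxy, coloringGraph_inj h hxy', hg]

/-- One stage of the iteration, stated for the graph `G`: a rainbow for one coloring with this graph
serves all of them. If `G` is not the graph of a suitable coloring computable in `X`, nothing is
added. -/
theorem exists_low_extension (X : {X // Low X}) (G : ℕ → Bool) : ∃ Y : {Y // Low Y},
    SetTuringReducible X.1 Y.1 ∧ (SetTuringReducible G X.1 → ∀ f, coloringGraph f = G →
      TwoBounded f → RainbowStable f →
      ∃ R, SetTuringReducible R Y.1 ∧ {n | R n = true}.Infinite ∧ IsRainbow f R) := by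
  by_cases h : ∃ f, coloringGraph f = G ∧ SetTuringReducible G X.1 ∧ TwoBounded f ∧ RainbowStable f
  · obtain ⟨f, rfl, hX, hf, hs⟩ := h
    obtain ⟨P, R, hP, hR, hinf, hrain⟩ := exists_low_rainbow hX hf hs
    exact ⟨⟨_, hP.low_join X.2⟩, left_le_join _ _, fun _ g hg _ _ =>
      ⟨R, hR, hinf, hrain.of_coloringGraph_eq hg.symm⟩⟩
  · exact ⟨X, .refl _, fun hG f hf h1 h2 => (h ⟨f, hf, hG, h1, h2⟩).elim⟩

theorem exists_low_model : ∃ M : Set (ℕ → Bool), IsTuringIdeal M ∧ SatisfiesSRRT22 M ∧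
    ∀ A ∈ M, Low A := by
  obtain ⟨G, hG⟩ := (countable_setTuringReducible (jump fun _ => false)).exists_eq_range
    ⟨_, SetTuringReducible.refl _⟩
  choose next hle hnext using exists_low_extension
  set S : ℕ → {X // Low X} := fun n =>
    -- Stage `Nat.pair e m` treats `G e`, so each graph returns for every `m`. As `m ≤ Nat.pair e
    -- m`, a coloring computable at stage `m` is still computable when it is treated.
    Nat.rec ⟨fun _ => false, low_empty⟩ (fun n X => next X (G n.unpair.1)) n with hS
  have hsucc : ∀ n, S (n + 1) = next (S n) (G n.unpair.1) := fun n => rfl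
  have hmono : ∀ {m n}, m ≤ n → SetTuringReducible (S m).1 (S n).1 := fun {m n} h => by
    induction n, h using Nat.le_induction with
    | base => exact .refl _
    | succ n _ ih => exact ih.trans (by rw [hsucc]; exact hle _ _)
  refine ⟨{A | ∃ n, SetTuringReducible A (S n).1}, ⟨⟨_, 0, .refl _⟩, ?_, ?_⟩, ?_, ?_⟩
  · rintro A ⟨m, hA⟩ B ⟨n, hB⟩
    exact ⟨max m n, join_le (hA.trans (hmono (le_max_left _ _)))
      (hB.trans (hmono (le_max_right _ _)))⟩
  · rintro B ⟨n, hB⟩ A hA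
    exact ⟨n, hA.trans hB⟩
  · rintro f ⟨m, hm⟩ hf hs
    -- Lowness is used here: everything in the model is computable in `∅'` and therefore listed by
    -- the enumeration `G` fixed in advance.
    obtain ⟨e, he⟩ : coloringGraph f ∈ Set.range G :=
      hG ▸ hm.trans (S m).2.le_jump_empty
    obtain ⟨R, hR, hinf, hrain⟩ := hnext (S (Nat.pair e m)) (G e)
      (he ▸ hm.trans (hmono (Nat.right_le_pair e m))) f he.symm hf hs
    refine ⟨R, ⟨Nat.pair e m + 1, ?_⟩, hinf, hrain⟩
    rw [hsucc, Nat.unpair_pair]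
    exact hR
  · rintro A ⟨n, hA⟩
    exact (S n).2.of_reducible hA

theorem mainTheorem12 :
    (∀ (X : ℕ → Bool) (T : Set (List Bool)),
      IsBinaryTree T → SetComputableIn (jump X) T →
      0 < treeMeasure T → RealComputableIn (jump X) (treeMeasure T) →
      ∃ P ∈ paths T, LowOver X P) ∧
    ∃ M : Set (ℕ → Bool), IsTuringIdeal M ∧ SatisfiesSRRT22 M ∧ ∀ A ∈ M, Low A :=
  ⟨fun _ _ hT hTd hpos hr => exists_low_path hT hTd hpos hr, exists_low_model⟩
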